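/- Let $H$ be an infinite-dimensional real separable Hilbert space with norm $\|\cdot\|_H$, and let $a,b$ be symmetric bilinear forms on $H$ such that $a(v,w)\le C_a\|v\|_H\|w\|_H$ and $a(v,v)\ge c_a\|v\|_H^2$ for all $v,w\in H$, with constants $C_a,c_a>0$; $b$ is an inner product; and every $\|\cdot\|_H$-bounded sequence has a subsequence that is Cauchy in $\|v\|_b=\sqrt{b(v,v)}$. Write $\|v\|=\sqrt{a(v,v)}$. Let $0<\lambda_1<\lambda_2<\cdots$ be the distinct eigenvalues of the problem $a(u,v)=\lambda b(u,v)$ for all $v\in H$ ($0\ne u\in H$), $\lambda_0=0$, let $M(\lambda_i)$ be the eigenspaces and $d_i=\dim M(\lambda_i)$. Fix $q\ge1$ and put $N=d_1+\cdots+d_q$. For subspaces $U\neq\{0\}$ and $V$ of $H$ let $$\operatorname{dist}(U,V)=\sup_{u\in U,\ \|u\|=1}\ \inf_{v\in V}\|u-v\|,\qquad \operatorname{dist}(u,v)=\operatorname{dist}(\operatorname{span}\{u\},\operatorname{span}\{v\}).$$ For a finite-dimensional subspace $V^h\subset H$ with $\dim V^h\ge N$, put $\delta=\operatorname{dist}\big(\bigoplus_{i=1}^q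 M(\lambda_i),V^h\big)$. The discrete problem is to find $\lambda^h\in\mathbb{R}$ and $0\ne u^h\in V^h$ with $a(u^h,v)=\lambda^h b(u^h,v)$ for all $v\in V^h$. A discrete eigensystem of $V^h$ consists of all $\dim V^h$ eigenvalues of this problem, counted with multiplicity and listed in nondecreasing order, with $b$-orthonormal eigenfunctions. Its first $N$ members are labelled $u^h_{ij}$, $1\le i\le q$, $1\le j\le d_i$, in lexicographic order of $(i,j)$. Call a pair $(\epsilon_*,C_*)$ with $0<\epsilon_*<1$ and $C_*>0$ admissible if, for every such $V^h$ with $\delta\le\epsilon_*$ and every discrete eigensystem of $V^h$, there are $\hat u_{ij}\in M(\lambda_i)$ with $$\|u^h_{ij}-\hat u_{ij}\|\le C_*\,\delta\qquad(1\le i\le q,\ 1\le j\le d_i).$$ Theorem. 1. Admissible pairs, with $C_*$ independent of $V^h$, exist; more precisely, for every $\alpha\in(0,1)$ there is a $C_*$ such that $(\epsilon_*,C_*)$ is admissible with $\epsilon_*=\alpha\min_{1\le i\le q+1}\sqrt{(\lambda_i-\lambda_{i-1})/\lambda_i}$. 2. Let $(\epsilon_*,C_*)$ be any admissible pair. For every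 $V^h$ as above with $\delta\le\epsilon_*$ and every discrete eigensystem of $V^h$, there are bases $\{u^o_{ij}\}_{j=1}^{d_i}$ of $M(\lambda_i)$, $i=1,\dots,q$, with $b(u^o_{ij},u^o_{kl})=\delta_{ik}\delta_{jl}$ and $$\operatorname{dist}(u^o_{ij},u^h_{ij})\le C_{**}\,\delta\quad(1\le i\le q,\ 1\le j\le d_i),\qquad C_{**}=\max_{1\le i\le q}\frac{2(\sqrt{d_i}+1)}{\sqrt{\lambda_i}}\,C_* .$$ -/

import Mathlib

namespace ClusterEig

noncomputable section

variable {H : Type*} [NormedAddCommGroup H] [InnerProductSpace ℝ H]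

/-- The norm `‖v‖_a = √(a(v,v))` of a bilinear form `a`. -/
def formNorm (a : LinearMap.BilinForm ℝ H) (v : H) : ℝ := Real.sqrt (a v v)

/-- The norm `‖·‖_b` is compact with respect to the norm of `H`: every sequence bounded in `H`
has a subsequence that is Cauchy in `‖·‖_b`. -/
def FormNormCompact (b : LinearMap.BilinForm ℝ H) : Prop :=
  ∀ x : ℕ → H, (∃ R : ℝ, ∀ n, ‖x n‖ ≤ R) →
    ∃ φ : ℕ → ℕ, StrictMono φ ∧
      ∀ η : ℝ, 0 < η → ∃ n₀ : ℕ, ∀ m n : ℕ, n₀ ≤ m → n₀ ≤ n →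
        formNorm b (x (φ m) - x (φ n)) < η

/-- The space of all `u` with `a(u,v) = μ b(u,v)` for every `v ∈ H`. -/
def eigenspace (a b : LinearMap.BilinForm ℝ H) (μ : ℝ) : Submodule ℝ H where
  carrier := {u | ∀ v : H, a u v = μ * b u v}
  add_mem' := by
    intro x y hx hy v
    have h1 := hx v
    have h2 := hy v
    simp only [map_add, LinearMap.add_apply, h1, h2]
    ring
  zero_mem' := by
    intro v
    simp
  smul_mem' := by
    intro c x hx v
    have h1 := hx v
    simp only [map_smul, LinearMap.smul_apply, smul_eq_mul, h1]
    ring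

/-- `μ` is an eigenvalue: there is `u ≠ 0` with `a(u,v) = μ b(u,v)` for every `v ∈ H`. -/
def IsEigenvalue (a b : LinearMap.BilinForm ℝ H) (μ : ℝ) : Prop :=
  ∃ u : H, u ≠ 0 ∧ ∀ v : H, a u v = μ * b u v

/-- `λ₀ = 0`, and `λ_{n+1}` is the smallest eigenvalue greater than `λ_n`; thus
`λ₁ < λ₂ < ⋯` are the distinct eigenvalues in increasing order. -/
def eigval (a b : LinearMap.BilinForm ℝ H) : ℕ → ℝ
  | 0 => 0
  | n + 1 => sInf {μ : ℝ | IsEigenvalue a b μ ∧ eigval a b n < μ}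

/-- The eigenspace `M(λ_i)`. -/
def M (a b : LinearMap.BilinForm ℝ H) (i : ℕ) : Submodule ℝ H :=
  eigenspace a b (eigval a b i)

/-- The multiplicity `d_i = dim M(λ_i)` (and `d₀ = 0`, since `M(0) = 0` for definite `a`). -/
def mult (a b : LinearMap.BilinForm ℝ H) (i : ℕ) : ℕ :=
  Module.finrank ℝ (M a b i)

/-- The sum `M(λ₁) ⊕ ⋯ ⊕ M(λ_q)`. -/
def clusterSpace (a b : LinearMap.BilinForm ℝ H) (q : ℕ) : Submodule ℝ H :=
  ⨆ i ∈ Finset.Icc 1 q, M a b i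

/-- `dist(U,V) = sup_{u ∈ U, ‖u‖_a = 1} inf_{v ∈ V} ‖u - v‖_a`. -/
def subspaceDist (a : LinearMap.BilinForm ℝ H) (U V : Submodule ℝ H) : ℝ :=
  ⨆ u : {u : H // u ∈ U ∧ formNorm a u = 1}, ⨅ v : V, formNorm a ((u : H) - (v : H))

/-- `dist(u,v) = dist(span{u}, span{v})`. -/
def vecDist (a : LinearMap.BilinForm ℝ H) (u v : H) : ℝ :=
  subspaceDist a (Submodule.span ℝ {u}) (Submodule.span ℝ {v})

/-- `(lamh k, uh k)`, `k = 0, …, dim V - 1`, is a complete list of eigenpairs of the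
discretization on `V` (find `λ` and `0 ≠ u ∈ V` with `a(u,v) = λ b(u,v)` for all `v ∈ V`),
with eigenvalues in nondecreasing order and `b`-orthonormal eigenfunctions. Values at
`k ≥ dim V` play no role. -/
structure IsDiscreteEigensystem (a b : LinearMap.BilinForm ℝ H) (V : Submodule ℝ H)
    (lamh : ℕ → ℝ) (uh : ℕ → H) : Prop where
  mem : ∀ k, k < Module.finrank ℝ V → uh k ∈ V
  eigen : ∀ k, k < Module.finrank ℝ V → ∀ v ∈ V, a (uh k) v = lamh k * b (uh k) v
  orthonormal : ∀ k l, k < Module.finrank ℝ V → l < Module.finrank ℝ V →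
    b (uh k) (uh l) = if k = l then 1 else 0
  sorted : ∀ k l, k ≤ l → l < Module.finrank ℝ V → lamh k ≤ lamh l

/-- The position `d₁ + ⋯ + d_{i-1} + j` of the index pair `(i,j)` in the lexicographic order
(here `d₀ = 0`, and `j` starts from `0`). -/
def idx (a b : LinearMap.BilinForm ℝ H) (i j : ℕ) : ℕ :=
  (∑ k ∈ Finset.range i, mult a b k) + j

/-- `N = d₁ + ⋯ + d_q`. -/
def clusterDim (a b : LinearMap.BilinForm ℝ H) (q : ℕ) : ℕ :=
  ∑ i ∈ Finset.Icc 1 q, mult a b i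

/-- `(ε, C)` are constants, independent of the discretization space `V`, for which each of the
first `N` discrete eigenfunctions `u^h_{ij}` is within `C · dist(M(λ₁) ⊕ ⋯ ⊕ M(λ_q), V)` of
`M(λ_i)` as soon as `dist(M(λ₁) ⊕ ⋯ ⊕ M(λ_q), V) ≤ ε`. -/
def IsApproxConst (a b : LinearMap.BilinForm ℝ H) (q : ℕ) (ε C : ℝ) : Prop :=
  0 < ε ∧ ε < 1 ∧ 0 < C ∧
  ∀ V : Submodule ℝ H, FiniteDimensional ℝ V → clusterDim a b q ≤ Module.finrank ℝ V →
    ∀ (lamh : ℕ → ℝ) (uh : ℕ → H), IsDiscreteEigensystem a b V lamh uh →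
      subspaceDist a (clusterSpace a b q) V ≤ ε →
      ∀ i ∈ Finset.Icc 1 q, ∀ j : Fin (mult a b i),
        ∃ w ∈ M a b i,
          formNorm a (uh (idx a b i j) - w) ≤ C * subspaceDist a (clusterSpace a b q) V

/-- `α · min_{i = 1, …, q+1} √((λ_i - λ_{i-1}) / λ_i)`. -/
def gapThreshold (a b : LinearMap.BilinForm ℝ H) (q : ℕ) (α : ℝ) : ℝ :=
  α * (Finset.Icc 1 (q + 1)).inf' (Finset.nonempty_Icc.2 (Nat.le_add_left 1 q))
    (fun i => Real.sqrt ((eigval a b i - eigval a b (i - 1)) / eigval a b i))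

/-- `C_{**} = max_{i = 1, …, q} (2 (√d_i + 1) / √λ_i) C`. -/
def basisConst (a b : LinearMap.BilinForm ℝ H) (q : ℕ) (hq : 1 ≤ q) (C : ℝ) : ℝ :=
  (Finset.Icc 1 q).sup' (Finset.nonempty_Icc.2 hq)
    (fun i => 2 * (Real.sqrt (mult a b i : ℝ) + 1) / Real.sqrt (eigval a b i) * C)

end

end ClusterEig

/-!
Everything is expressed through the two forms `a` and `b`.

**Spectral theory.** On a closed nonzero subspace the Rayleigh quotient `a(v,v) / b(v,v)` has a
minimizer: compactness of `b` and the parallelogram identity for `a` make a minimizing sequence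
converge along a subsequence (`IsFormPair.exists_rayleigh_min`). Applied to the orthogonal complement of
`E_n = M(λ₁) ⊕ ⋯ ⊕ M(λ_n)`, this shows by induction that `λ_{n+1}` is an eigenvalue, that it exceeds
`λ_n`, and that `λ_{n+1} b ≤ a` on that complement (`IsFormPair.eigval_succ_spec`).

**Discrete eigenvalues.** A dimension count gives, for the discrete eigenvalues `λ^h` at the
positions belonging to `λ_i`, the bounds `λ_i ≤ λ^h` and `λ^h (1 - δ²) ≤ λ_i`
(`IsDiscreteEigensystem.eigval_le_value`, `IsDiscreteEigensystem.value_mul_le_eigval`). The threshold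
`δ² ≤ α² (λ_{i+1} - λ_i) / λ_{i+1}` then keeps `λ^h` below `λ_{i+1}` by
`(1 - α²) (λ_{i+1} - λ_i)`, uniformly in `V`.

**Discrete eigenfunctions.** Split `u^h = e + f + r` with `e ∈ E_{i-1}`, `f ∈ M(λ_i)` and
`r ⊥ E_i`, and let `P` be the `a`-orthogonal projection onto `V`. Testing the continuous and the
discrete equation gives `λ^h b(e,e) - a(e,e) = λ^h b(u^h, e - Pe)`. The left side is at least
`(λ_i - λ_{i-1}) b(e,e)` and the right side is of order `δ √b(e,e)`, so `b(e,e)` is of order `δ²`.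
The identity `a(u^h,u^h) = λ^h b(u^h,u^h)` together with `λ^h - λ_i ≤ λ^h δ²` then bounds `a(r,r)`
by a multiple of `δ²` (`IsFormPair.exists_near_eigenvector`). This proves that admissible pairs
exist (`IsFormPair.exists_isApproxConst`).

**Orthonormal bases.** The projections of the `u^h_{ij}` to `M(λ_i)` have a Gram matrix that is at
most the identity, so their polar factor is a `b`-orthonormal basis `u^o_{ij}`, in the
norm of `b` no farther from the projections than the `u^h_{ij}` are
(`IsInnerForm.exists_orthonormal_near`). Comparing `b` with
`a` on the two error terms gives `dist(u^o_{ij}, u^h_{ij}) ≤ 2 C δ / √λ₁`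
(`IsFormPair.exists_basis_near`), and the term `i = 1` of the maximum that defines `C_{**}` is
already at least `2 C / √λ₁`.
-/

namespace ClusterEig

/-! ### Inner products as bilinear forms -/

/-- A symmetric positive definite real bilinear form. Both `a` and `b` are of this kind, and
treating them as forms avoids putting several inner product structures on one type. -/
structure IsInnerForm {W : Type*} [AddCommGroup W] [Module ℝ W]
    (c : LinearMap.BilinForm ℝ W) : Prop where
  symm : ∀ v w, c v w = c w v
  pos : ∀ v, v ≠ 0 → 0 < c v v

section Forms

variable {W : Type*} [AddCommGroup W] [Module ℝ W] {c : LinearMap.BilinForm ℝ W}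

/-- The Cauchy–Schwarz inequality for a positive semidefinite symmetric form. -/
theorem form_sq_le (hs : ∀ v w, c v w = c w v) (hp : ∀ v, 0 ≤ c v v) (v w : W) :
    c v w ^ 2 ≤ c v v * c w w := by
  have h := LinearMap.BilinForm.apply_mul_apply_le_of_forall_zero_le c hp v w
  rwa [hs w v, ← sq] at h

theorem form_add_self (hs : ∀ v w, c v w = c w v) (v w : W) :
    c (v + w) (v + w) = c v v + 2 * c v w + c w w := by
  simp only [map_add, LinearMap.add_apply, hs w v]
  ring

theorem form_sub_self (hs : ∀ v w, c v w = c w v) (v w : W) :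
    c (v - w) (v - w) = c v v - 2 * c v w + c w w := by
  simp only [map_sub, LinearMap.sub_apply, hs w v]
  ring

theorem form_smul_self (t : ℝ) (v : W) : c (t • v) (t • v) = t ^ 2 * c v v := by
  simp only [map_smul, LinearMap.smul_apply, smul_eq_mul]
  ring

theorem form_sum_left {ι : Type*} (s : Finset ι) (x : ι → W) (v : W) :
    c (∑ k ∈ s, x k) v = ∑ k ∈ s, c (x k) v := by
  rw [map_sum, LinearMap.sum_apply]

theorem form_eq_zero_of_mem_span {s : Set W} {v : W} (h : ∀ w ∈ s, c v w = 0) {w : W}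
    (hw : w ∈ Submodule.span ℝ s) : c v w = 0 :=
  (Submodule.span_le (p := LinearMap.ker (c v))).2 (fun x hx => h x hx) hw

theorem IsInnerForm.nonneg (hc : IsInnerForm c) (v : W) : 0 ≤ c v v := by
  by_cases h : v = 0
  · simp [h]
  · exact (hc.pos v h).le

theorem IsInnerForm.eq_zero (hc : IsInnerForm c) {v : W} (h : c v v = 0) : v = 0 := by
  by_contra h0
  exact (hc.pos v h0).ne' h

/-- Orthogonal projection onto a finite-dimensional subspace. -/
theorem IsInnerForm.exists_proj (hc : IsInnerForm c) (U : Submodule ℝ W)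
    [FiniteDimensional ℝ U] (v : W) : ∃ u ∈ U, ∀ w ∈ U, c (v - u) w = 0 := by
  let L : U →ₗ[ℝ] Module.Dual ℝ U := c.restrict U
  have hinj : Function.Injective L := by
    refine (injective_iff_map_eq_zero L).2 fun u hu => ?_
    exact Subtype.ext (hc.eq_zero (LinearMap.congr_fun hu u))
  have hsurj : Function.Surjective L :=
    (LinearMap.injective_iff_surjective_of_finrank_eq_finrank
      (Subspace.dual_finrank_eq (K := ℝ) (V := U)).symm).1 hinj
  obtain ⟨u, hu⟩ := hsurj ((c v).comp U.subtype)
  refine ⟨u, u.2, fun w hw => ?_⟩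
  have h : c u w = c v w := LinearMap.congr_fun hu ⟨w, hw⟩
  rw [map_sub, LinearMap.sub_apply, h, sub_self]

/-- If `dim X < dim U`, some nonzero vector of `U` is orthogonal to `X`. This is the dimension
count behind both min-max bounds for the discrete eigenvalues. -/
theorem exists_ne_zero_orthogonal (c : LinearMap.BilinForm ℝ W) (U X : Submodule ℝ W)
    [FiniteDimensional ℝ U] [FiniteDimensional ℝ X]
    (h : Module.finrank ℝ X < Module.finrank ℝ U) :
    ∃ u ∈ U, u ≠ 0 ∧ ∀ w ∈ X, c u w = 0 := by
  let L : U →ₗ[ℝ] Module.Dual ℝ X :=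
    (LinearMap.lcomp ℝ ℝ X.subtype).comp (LinearMap.comp c U.subtype)
  have hk : LinearMap.ker L ≠ ⊥ := LinearMap.ker_ne_bot_of_finrank_lt
    (by rwa [Subspace.dual_finrank_eq (K := ℝ) (V := X)])
  obtain ⟨u, hu, hu0⟩ := (Submodule.ne_bot_iff _).1 hk
  exact ⟨u, u.2, fun h0 => hu0 (Subtype.ext h0),
    fun w hw => LinearMap.congr_fun (LinearMap.mem_ker.1 hu) ⟨w, hw⟩⟩

/-- A contraction between inner product spaces of equal finite dimension is as close to some
isometry (its polar factor) as its defect `1 - ‖A e‖²` allows: singular values `s ∈ [0, 1]`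
satisfy `(1 - s)² ≤ 1 - s²`. -/
theorem exists_orthonormalBasis_near {E F : Type*} [NormedAddCommGroup E]
    [InnerProductSpace ℝ E] [FiniteDimensional ℝ E] [NormedAddCommGroup F]
    [InnerProductSpace ℝ F] [FiniteDimensional ℝ F] {d : ℕ}
    (hF : Module.finrank ℝ F = d) (e : OrthonormalBasis (Fin d) ℝ E) (A : E →ₗ[ℝ] F)
    (hA : ∀ x, ‖A x‖ ≤ ‖x‖) :
    ∃ g : OrthonormalBasis (Fin d) ℝ F, ∀ j, ‖g j - A (e j)‖ ^ 2 ≤ 1 - ‖A (e j)‖ ^ 2 := by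
  have hE : Module.finrank ℝ E = d := by
    rw [Module.finrank_eq_card_basis e.toBasis, Fintype.card_fin]
  -- A right singular basis: orthonormal vectors with orthogonal images.
  let T := A.adjoint ∘ₗ A
  have hT : T.IsSymmetric := A.isSymmetric_adjoint_comp_self
  let f := hT.eigenvectorBasis hE
  have hAf : ∀ i j, i ≠ j → inner ℝ (A (f i)) (A (f j)) = 0 := by
    intro i j hij
    have h1 : inner ℝ (A (f i)) (A (f j)) = inner ℝ (T (f i)) (f j) := by
      simp only [T, LinearMap.comp_apply, LinearMap.adjoint_inner_left]
    rw [h1, hT.apply_eigenvectorBasis hE i, inner_smul_left, f.inner_eq_ite]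
    simp [hij]
  let v : Fin d → F := fun i => ‖A (f i)‖⁻¹ • A (f i)
  let s : Set (Fin d) := {i | ‖A (f i)‖ ≠ 0}
  have hv : Orthonormal ℝ (s.domRestrict v) := by
    constructor
    · rintro ⟨i, hi⟩
      have hi' : ‖A (f i)‖ ≠ 0 := hi
      simp only [Set.domRestrict_apply, v, norm_smul, norm_inv, norm_norm]
      exact inv_mul_cancel₀ hi'
    · rintro ⟨i, hi⟩ ⟨j, hj⟩ hij
      have hij' : i ≠ j := fun h => hij (Subtype.ext h)
      simp only [Set.domRestrict_apply, v, inner_smul_left, inner_smul_right, hAf i j hij',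
        mul_zero]
  obtain ⟨g₀, hg₀⟩ := Orthonormal.exists_orthonormalBasis_extension_of_card_eq
    (by rw [hF, Fintype.card_fin]) hv
  have hAg : ∀ i, A (f i) = ‖A (f i)‖ • g₀ i := by
    intro i
    by_cases hi : ‖A (f i)‖ = 0
    · rw [hi, zero_smul, norm_eq_zero.1 hi]
    · rw [hg₀ i hi]
      simp only [v, smul_smul, mul_inv_cancel₀ hi, one_smul]
  let U : E ≃ₗᵢ[ℝ] F := f.equiv g₀ (Equiv.refl _)
  have hAx : ∀ x, A x = ∑ i, (f.repr x i * ‖A (f i)‖) • g₀ i := by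
    intro x
    conv_lhs => rw [← f.sum_repr x, map_sum]
    refine Finset.sum_congr rfl fun i _ => ?_
    rw [map_smul, mul_smul, ← hAg i]
  have hUx : ∀ x, U x = ∑ i, f.repr x i • g₀ i := by
    intro x
    conv_lhs => rw [← f.sum_repr x, map_sum]
    refine Finset.sum_congr rfl fun i _ => ?_
    rw [map_smul, OrthonormalBasis.equiv_apply_basis, Equiv.refl_apply]
  have hnorm : ∀ y : Fin d → ℝ, ‖∑ i, y i • g₀ i‖ ^ 2 = ∑ i, y i ^ 2 := by
    intro y
    rw [← real_inner_self_eq_norm_sq, g₀.orthonormal.inner_sum]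
    simp [sq]
  refine ⟨e.map U, fun j => ?_⟩
  have hone : (1 : ℝ) = ∑ i, f.repr (e j) i ^ 2 := by
    rw [← hnorm, ← hUx, U.norm_map, e.orthonormal.1 j, one_pow]
  rw [OrthonormalBasis.map_apply, hUx, hAx, ← Finset.sum_sub_distrib, hnorm]
  simp only [← sub_smul]
  rw [hnorm, hone, ← Finset.sum_sub_distrib]
  refine Finset.sum_le_sum fun i _ => ?_
  have h1 : ‖A (f i)‖ ≤ 1 := (hA (f i)).trans (f.orthonormal.1 i).le
  have h0 : 0 ≤ ‖A (f i)‖ := norm_nonneg _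
  nlinarith [mul_nonneg (sq_nonneg (f.repr (e j) i)) (mul_nonneg h0 (sub_nonneg.2 h1))]

/-- Symmetric orthogonalization of a family whose Gram matrix is at most the identity: there is
an orthonormal basis with squared distances at most the defects `1 - c (v j) (v j)`. -/
theorem IsInnerForm.exists_orthonormal_near (hc : IsInnerForm c) [FiniteDimensional ℝ W]
    {d : ℕ} (hd : Module.finrank ℝ W = d) (v : Fin d → W)
    (hv : ∀ x : Fin d → ℝ, c (∑ j, x j • v j) (∑ j, x j • v j) ≤ ∑ j, x j ^ 2) :
    ∃ g : Fin d → W, Submodule.span ℝ (Set.range g) = ⊤ ∧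
      (∀ j l, c (g j) (g l) = if j = l then 1 else 0) ∧
      ∀ j, c (g j - v j) (g j - v j) ≤ 1 - c (v j) (v j) := by
  let core : InnerProductSpace.Core ℝ W :=
    { inner := fun x y => c x y
      conj_inner_symm := fun x y => hc.symm y x
      re_inner_nonneg := fun x => hc.nonneg x
      add_left := fun x y z => by simp
      smul_left := fun x y r => by simp
      definite := fun x hx => hc.eq_zero hx }
  let _ : NormedAddCommGroup W := core.toNormedAddCommGroup
  let _ : InnerProductSpace ℝ W := InnerProductSpace.ofCore core.toCore
  have hin : ∀ x y : W, inner ℝ x y = c x y := fun _ _ => rfl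
  have hn : ∀ x : W, ‖x‖ ^ 2 = c x x := fun x => (real_inner_self_eq_norm_sq x).symm
  let e := EuclideanSpace.basisFun (Fin d) ℝ
  let A : EuclideanSpace ℝ (Fin d) →ₗ[ℝ] W := e.toBasis.constr ℝ v
  have hAe : ∀ j, A (e j) = v j := by
    intro j
    have := e.toBasis.constr_basis ℝ v j
    rwa [e.coe_toBasis] at this
  have hA : ∀ x, ‖A x‖ ≤ ‖x‖ := by
    intro x
    refine le_of_sq_le_sq ?_ (norm_nonneg _)
    have h1 : A x = ∑ j, x j • v j := by
      conv_lhs => rw [← e.sum_repr x, map_sum]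
      refine Finset.sum_congr rfl fun i _ => ?_
      rw [map_smul, hAe]
      rfl
    rw [hn, h1, EuclideanSpace.real_norm_sq_eq]
    exact hv _
  obtain ⟨g, hg⟩ := exists_orthonormalBasis_near hd e A hA
  refine ⟨g, ?_, fun j l => ?_, fun j => ?_⟩
  · rw [← g.coe_toBasis]
    exact g.toBasis.span_eq
  · rw [← hin, g.inner_eq_ite]
  · have := hg j
    rwa [hn, hn, hAe] at this

end Forms

/-! ### Spectral theory of the continuous problem -/

/-- The standing assumptions on the pair `(a, b)`: two inner products, `a` equivalent to the inner
product of `H`, and `b` compact relative to it. -/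
structure IsFormPair {H : Type*} [NormedAddCommGroup H] [InnerProductSpace ℝ H]
    (a b : LinearMap.BilinForm ℝ H) : Prop where
  inner_left : IsInnerForm a
  inner_right : IsInnerForm b
  bdd : ∃ Ca : ℝ, 0 < Ca ∧ ∀ v, a v v ≤ Ca * ‖v‖ ^ 2
  coer : ∃ ca : ℝ, 0 < ca ∧ ∀ v, ca * ‖v‖ ^ 2 ≤ a v v
  cpt : FormNormCompact b

section Spectral

variable {H : Type*} [NormedAddCommGroup H] [InnerProductSpace ℝ H]
  {a b : LinearMap.BilinForm ℝ H}

theorem formNorm_sq {c : LinearMap.BilinForm ℝ H} (hc : IsInnerForm c) (v : H) :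
    formNorm c v ^ 2 = c v v :=
  Real.sq_sqrt (hc.nonneg v)

theorem formNorm_nonneg (c : LinearMap.BilinForm ℝ H) (v : H) : 0 ≤ formNorm c v :=
  Real.sqrt_nonneg _

theorem form_lt_sq_of_formNorm_lt {c : LinearMap.BilinForm ℝ H} (hc : IsInnerForm c) {v : H}
    {η : ℝ} (h : formNorm c v < η) : c v v < η ^ 2 := by
  rw [← formNorm_sq hc]
  exact pow_lt_pow_left₀ h (formNorm_nonneg c v) two_ne_zero

theorem IsFormPair.exists_right_le (h : IsFormPair a b) :
    ∃ Cb : ℝ, 0 < Cb ∧ ∀ v, b v v ≤ Cb * ‖v‖ ^ 2 := by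
  have hb := h.inner_right
  by_contra! hcon
  have hx : ∀ n : ℕ, ∃ x : H, ‖x‖ = 1 ∧ (n : ℝ) < b x x := by
    intro n
    obtain ⟨v, hv⟩ := hcon (n + 1) (by positivity)
    have hv0 : v ≠ 0 := by
      rintro rfl
      simp at hv
    have hn : 0 < ‖v‖ := norm_pos_iff.2 hv0
    refine ⟨‖v‖⁻¹ • v, ?_, ?_⟩
    · rw [norm_smul, norm_inv, norm_norm, inv_mul_cancel₀ hn.ne']
    · rw [form_smul_self, inv_pow, inv_mul_eq_div, lt_div_iff₀ (by positivity)]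
      nlinarith [sq_nonneg ‖v‖]
  choose x hx1 hxb using hx
  obtain ⟨φ, hφ, hC⟩ := h.cpt x ⟨1, fun n => (hx1 n).le⟩
  obtain ⟨n₀, hn₀⟩ := hC 1 one_pos
  obtain ⟨m, hm⟩ := exists_nat_gt (2 + 2 * b (x (φ n₀)) (x (φ n₀)))
  let k := max m n₀
  have h1 : b (x (φ k) - x (φ n₀)) (x (φ k) - x (φ n₀)) < 1 ^ 2 :=
    form_lt_sq_of_formNorm_lt hb (hn₀ k n₀ (le_max_right _ _) le_rfl)
  have h2 := form_sub_self hb.symm (x (φ k)) (x (φ n₀))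
  have h3 := hb.nonneg (x (φ k) - (2 : ℝ) • x (φ n₀))
  rw [form_sub_self hb.symm, form_smul_self, map_smul, smul_eq_mul] at h3
  have h4 : (m : ℝ) < b (x (φ k)) (x (φ k)) :=
    lt_of_le_of_lt (Nat.cast_le.2 ((le_max_left m n₀).trans (hφ.id_le k))) (hxb _)
  nlinarith

theorem IsInnerForm.continuous {c : LinearMap.BilinForm ℝ H} (hc : IsInnerForm c)
    (hbdd : ∃ C : ℝ, 0 < C ∧ ∀ v, c v v ≤ C * ‖v‖ ^ 2) :
    Continuous fun p : H × H => c p.1 p.2 := by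
  obtain ⟨C, hC, hle⟩ := hbdd
  have key : ∀ x y, ‖c x y‖ ≤ C * ‖x‖ * ‖y‖ := by
    intro x y
    rw [Real.norm_eq_abs]
    refine abs_le_of_sq_le_sq ?_ (by positivity)
    calc c x y ^ 2 ≤ c x x * c y y := form_sq_le hc.symm hc.nonneg x y
      _ ≤ (C * ‖x‖ ^ 2) * (C * ‖y‖ ^ 2) :=
        mul_le_mul (hle x) (hle y) (hc.nonneg y) (by positivity)
      _ = (C * ‖x‖ * ‖y‖) ^ 2 := by ring
  exact (LinearMap.mkContinuous₂ c C key).continuous₂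

theorem IsFormPair.continuous_left (h : IsFormPair a b) :
    Continuous fun p : H × H => a p.1 p.2 :=
  h.inner_left.continuous h.bdd

theorem IsFormPair.continuous_right (h : IsFormPair a b) :
    Continuous fun p : H × H => b p.1 p.2 :=
  h.inner_right.continuous h.exists_right_le

/-- Compactness of `b` upgrades to convergence in `H` for sequences whose `a`-distances are
controlled by their `b`-distances up to a vanishing error. -/
theorem IsFormPair.exists_subseq_tendsto [CompleteSpace H] (h : IsFormPair a b) {x : ℕ → H}
    (hx : ∃ R : ℝ, ∀ n, ‖x n‖ ≤ R) {r : ℕ → ℝ} (hr : Filter.Tendsto r Filter.atTop (nhds 0))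
    {K : ℝ} (hK : 0 ≤ K)
    (hxr : ∀ m n, a (x m - x n) (x m - x n) ≤ r m + r n + K * b (x m - x n) (x m - x n)) :
    ∃ (y : H) (φ : ℕ → ℕ), StrictMono φ ∧
      Filter.Tendsto (x ∘ φ) Filter.atTop (nhds y) := by
  obtain ⟨ca, hca, hcoer⟩ := h.coer
  obtain ⟨φ, hφ, hC⟩ := h.cpt x hx
  have hcau : CauchySeq (x ∘ φ) := by
    rw [Metric.cauchySeq_iff]
    intro ε hε
    have hτ : 0 < ca * ε ^ 2 / 4 := by positivity
    set τ := ca * ε ^ 2 / 4 with hτd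
    obtain ⟨N₁, hN₁⟩ := Filter.eventually_atTop.1
      ((hr.comp hφ.tendsto_atTop).eventually (gt_mem_nhds hτ))
    have hη : 0 < Real.sqrt (τ / (K + 1)) := Real.sqrt_pos.2 (by positivity)
    obtain ⟨N₂, hN₂⟩ := hC _ hη
    refine ⟨max N₁ N₂, fun m hm n hn => ?_⟩
    have h1 : r (φ m) < τ := hN₁ m ((le_max_left _ _).trans hm)
    have h2 : r (φ n) < τ := hN₁ n ((le_max_left _ _).trans hn)
    have h3 := form_lt_sq_of_formNorm_lt h.inner_right
      (hN₂ m n ((le_max_right _ _).trans hm) ((le_max_right _ _).trans hn))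
    rw [Real.sq_sqrt (by positivity), lt_div_iff₀ (by positivity)] at h3
    have h4 := hxr (φ m) (φ n)
    have h5 := hcoer (x (φ m) - x (φ n))
    have h6 := h.inner_right.nonneg (x (φ m) - x (φ n))
    rw [dist_eq_norm]
    refine lt_of_pow_lt_pow_left₀ 2 hε.le ?_
    have h7 : ca * ‖x (φ m) - x (φ n)‖ ^ 2 < ca * ε ^ 2 := by nlinarith
    exact lt_of_mul_lt_mul_left h7 hca.le
  obtain ⟨y, hy⟩ := cauchySeq_tendsto_of_complete hcau
  exact ⟨y, φ, hφ, hy⟩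

theorem IsFormPair.isClosed_eigenspace (h : IsFormPair a b) (μ : ℝ) :
    IsClosed (eigenspace a b μ : Set H) := by
  have : (eigenspace a b μ : Set H) = ⋂ v, {u | a u v = μ * b u v} := by
    ext u
    simp only [Set.mem_iInter, Set.mem_ofPred_eq]
    exact Iff.rfl
  rw [this]
  refine isClosed_iInter fun v => isClosed_eq ?_ ?_
  · exact h.continuous_left.comp (continuous_id.prodMk continuous_const)
  · exact continuous_const.mul (h.continuous_right.comp (continuous_id.prodMk continuous_const))

theorem IsFormPair.finiteDimensional_eigenspace [CompleteSpace H] (h : IsFormPair a b) (μ : ℝ) :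
    FiniteDimensional ℝ (eigenspace a b μ) := by
  refine FiniteDimensional.of_isCompact_closedBall ℝ one_pos (c := 0) ?_
  refine IsSeqCompact.isCompact fun x hx => ?_
  have hx1 : ∀ n, ‖(x n : H)‖ ≤ 1 := fun n => mem_closedBall_zero_iff.1 (hx n)
  obtain ⟨y, φ, hφ, hy⟩ := h.exists_subseq_tendsto (x := fun n => (x n : H)) ⟨1, hx1⟩
    (r := fun _ => 0) tendsto_const_nhds (abs_nonneg μ) (fun m n => by
      have h1 : a (x m - x n : H) (x m - x n : H) = μ * b (x m - x n : H) (x m - x n : H) :=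
        (x m - x n).2 _
      rw [h1, add_zero, zero_add]
      exact mul_le_mul_of_nonneg_right (le_abs_self μ) (h.inner_right.nonneg _))
  have hyM : y ∈ eigenspace a b μ :=
    (h.isClosed_eigenspace μ).mem_of_tendsto hy (Filter.Eventually.of_forall fun n => (x (φ n)).2)
  refine ⟨⟨y, hyM⟩, ?_, φ, hφ, tendsto_subtype_rng.2 hy⟩
  exact mem_closedBall_zero_iff.2
    (le_of_tendsto hy.norm (Filter.Eventually.of_forall fun n => hx1 (φ n)))

/-- The Rayleigh quotient `a(v,v) / b(v,v)` attains its minimum on a closed nonzero subspace. -/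
theorem IsFormPair.exists_rayleigh_min [CompleteSpace H] (h : IsFormPair a b)
    (W : Submodule ℝ H) (hW : IsClosed (W : Set H)) (hne : W ≠ ⊥) :
    ∃ μ : ℝ, 0 < μ ∧ (∀ w ∈ W, μ * b w w ≤ a w w) ∧ ∃ x ∈ W, b x x = 1 ∧ a x x = μ := by
  have ha := h.inner_left
  have hb := h.inner_right
  have hscale : ∀ w ∈ W, w ≠ 0 → ∃ t : ℝ, t ^ 2 * b w w = 1 := by
    intro w _ hw0
    have hpos := hb.pos w hw0
    refine ⟨(Real.sqrt (b w w))⁻¹, ?_⟩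
    rw [inv_pow, Real.sq_sqrt hpos.le, inv_mul_cancel₀ hpos.ne']
  let S : Set ℝ := {s | ∃ v ∈ W, b v v = 1 ∧ a v v = s}
  have hS0 : ∀ s ∈ S, 0 ≤ s := by
    rintro s ⟨v, -, -, rfl⟩
    exact ha.nonneg v
  have hSne : S.Nonempty := by
    obtain ⟨w, hw, hw0⟩ := (Submodule.ne_bot_iff _).1 hne
    obtain ⟨t, ht⟩ := hscale w hw hw0
    exact ⟨_, t • w, W.smul_mem t hw, by rw [form_smul_self, ht], rfl⟩
  have hSb : BddBelow S := ⟨0, hS0⟩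
  let μ := sInf S
  have hμ0 : 0 ≤ μ := le_csInf hSne hS0
  have hmin : ∀ w ∈ W, μ * b w w ≤ a w w := by
    intro w hw
    by_cases hw0 : w = 0
    · simp [hw0]
    · obtain ⟨t, ht⟩ := hscale w hw hw0
      have h1 : μ ≤ a (t • w) (t • w) :=
        csInf_le hSb ⟨t • w, W.smul_mem t hw, by rw [form_smul_self, ht], rfl⟩
      rw [form_smul_self] at h1
      have h2 := mul_le_mul_of_nonneg_right h1 (hb.nonneg w)
      calc μ * b w w ≤ t ^ 2 * a w w * b w w := h2
        _ = t ^ 2 * b w w * a w w := by ring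
        _ = a w w := by rw [ht, one_mul]
  obtain ⟨s, -, hs, hsS⟩ := exists_seq_tendsto_sInf hSne hSb
  choose x hxW hxb hxa using hsS
  have hax : Filter.Tendsto (fun n => a (x n) (x n)) Filter.atTop (nhds μ) := by
    simpa only [hxa] using hs
  have hbound : ∃ R : ℝ, ∀ n, ‖x n‖ ≤ R := by
    obtain ⟨ca, hca, hcoer⟩ := h.coer
    obtain ⟨B, hB⟩ := hax.bddAbove_range
    refine ⟨Real.sqrt (B / ca), fun n => Real.le_sqrt_of_sq_le ?_⟩
    rw [le_div_iff₀ hca, mul_comm]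
    exact (hcoer (x n)).trans (hB ⟨n, rfl⟩)
  have hr : Filter.Tendsto (fun n => 2 * (a (x n) (x n) - μ)) Filter.atTop (nhds 0) := by
    have := (hax.sub_const μ).const_mul 2
    rwa [sub_self, mul_zero] at this
  -- The parallelogram identity makes a minimizing sequence Cauchy.
  obtain ⟨y, φ, hφ, hy⟩ := h.exists_subseq_tendsto hbound hr hμ0 (fun m n => by
    have h1 := hmin _ (W.add_mem (hxW m) (hxW n))
    rw [form_add_self ha.symm, form_add_self hb.symm, hxb, hxb] at h1
    rw [form_sub_self ha.symm, form_sub_self hb.symm, hxb, hxb]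
    linarith)
  have hyy : ∀ {c : LinearMap.BilinForm ℝ H}, (Continuous fun p : H × H => c p.1 p.2) →
      Filter.Tendsto (fun n => c (x (φ n)) (x (φ n))) Filter.atTop (nhds (c y y)) := by
    intro c hc
    exact (hc.tendsto (y, y)).comp (hy.prodMk_nhds hy)
  have hby : b y y = 1 := by
    refine tendsto_nhds_unique (hyy h.continuous_right) ?_
    simp only [hxb]
    exact tendsto_const_nhds
  have hay : a y y = μ :=
    tendsto_nhds_unique (hyy h.continuous_left) (hax.comp hφ.tendsto_atTop)
  refine ⟨μ, ?_, hmin, y, ?_, hby, hay⟩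
  · rw [← hay]
    refine ha.pos y ?_
    rintro rfl
    simp at hby
  · exact hW.mem_of_tendsto hy (Filter.Eventually.of_forall fun n => hxW _)

theorem IsFormPair.orthogonal_of_eigen (h : IsFormPair a b) {μ ν : ℝ} (hne : μ ≠ ν) {u w : H}
    (hu : u ∈ eigenspace a b μ) (hw : w ∈ eigenspace a b ν) : b u w = 0 := by
  have h1 : a u w = μ * b u w := hu w
  have h2 : a w u = ν * b w u := hw u
  rw [h.inner_left.symm, h.inner_right.symm, h1] at h2
  have h3 : (μ - ν) * b u w = 0 := by linarith
  exact (mul_eq_zero.1 h3).resolve_left (sub_ne_zero.2 hne)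

theorem clusterSpace_zero : clusterSpace a b 0 = ⊥ := by
  simp [clusterSpace]

theorem clusterSpace_succ (n : ℕ) :
    clusterSpace a b (n + 1) = clusterSpace a b n ⊔ M a b (n + 1) := by
  rw [clusterSpace, ← Finset.insert_Icc_right_eq_Icc_add_one (by omega), Finset.iSup_insert,
    sup_comm]
  rfl

theorem M_le_clusterSpace {i n : ℕ} (hi : i ∈ Finset.Icc 1 n) :
    M a b i ≤ clusterSpace a b n :=
  le_iSup₂_of_le i hi le_rfl

theorem clusterSpace_mono {m n : ℕ} (hmn : m ≤ n) : clusterSpace a b m ≤ clusterSpace a b n :=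
  iSup₂_le fun _ hi => M_le_clusterSpace (Finset.Icc_subset_Icc_right hmn hi)

theorem IsFormPair.finiteDimensional_clusterSpace [CompleteSpace H] (h : IsFormPair a b)
    (n : ℕ) : FiniteDimensional ℝ (clusterSpace a b n) := by
  induction n with
  | zero => rw [clusterSpace_zero]; infer_instance
  | succ n ih =>
    rw [clusterSpace_succ]
    have : FiniteDimensional ℝ (M a b (n + 1)) := h.finiteDimensional_eigenspace _
    infer_instance

/-- A vector that is `b`-orthogonal to every `M(λ_k)`, `1 ≤ k ≤ n`, is both `a`- and
`b`-orthogonal to their sum. -/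
theorem IsFormPair.orthogonal_clusterSpace (h : IsFormPair a b) {n : ℕ} {v : H}
    (hv : ∀ k ∈ Finset.Icc 1 n, ∀ w ∈ M a b k, b v w = 0) :
    ∀ w ∈ clusterSpace a b n, a v w = 0 ∧ b v w = 0 := by
  have hle : clusterSpace a b n ≤ LinearMap.ker (a v) ⊓ LinearMap.ker (b v) := by
    refine iSup₂_le fun k hk w hw => ?_
    have h1 : a w v = _ * b w v := hw v
    have h2 := hv k hk w hw
    refine ⟨?_, h2⟩
    change a v w = 0
    rw [h.inner_left.symm, h1, h.inner_right.symm, h2, mul_zero]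
  exact fun w hw => hle hw

theorem IsFormPair.left_orthogonal_clusterSpace (h : IsFormPair a b) {n : ℕ} {v : H}
    (hv : ∀ w ∈ clusterSpace a b n, b v w = 0) : ∀ w ∈ clusterSpace a b n, a v w = 0 :=
  fun w hw => (h.orthogonal_clusterSpace
    (fun _ hk w hw => hv w (M_le_clusterSpace hk hw)) w hw).1

/-- The eigenvalues are the successive minima of the Rayleigh quotient. -/
theorem IsFormPair.eigval_succ_spec [CompleteSpace H] (h : IsFormPair a b)
    (hH : ¬ FiniteDimensional ℝ H) (n : ℕ) :
    IsEigenvalue a b (eigval a b (n + 1)) ∧ eigval a b n < eigval a b (n + 1) ∧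
      ∀ v, (∀ w ∈ clusterSpace a b n, b v w = 0) → eigval a b (n + 1) * b v v ≤ a v v := by
  induction n using Nat.strong_induction_on with
  | _ n ih =>
  have ha := h.inner_left
  have hb := h.inner_right
  have := h.finiteDimensional_clusterSpace n
  let W : Submodule ℝ H :=
    { carrier := {v | ∀ w ∈ clusterSpace a b n, b v w = 0}
      add_mem' := fun {x y} hx hy w hw => by
        rw [map_add, LinearMap.add_apply, hx w hw, hy w hw, add_zero]
      zero_mem' := fun w _ => by simp
      smul_mem' := fun t x hx w hw => by
        rw [map_smul, LinearMap.smul_apply, hx w hw, smul_zero] }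
  have hWc : IsClosed (W : Set H) := by
    have : (W : Set H) = ⋂ w ∈ clusterSpace a b n, {v | b v w = 0} := by
      ext v
      simp only [Set.mem_iInter, Set.mem_ofPred_eq]
      exact Iff.rfl
    rw [this]
    exact isClosed_biInter fun w _ => isClosed_eq
      (h.continuous_right.comp (continuous_id.prodMk continuous_const)) continuous_const
  have hWne : W ≠ ⊥ := by
    intro hbot
    refine hH ?_
    have htop : clusterSpace a b n = ⊤ := by
      refine eq_top_iff.2 fun v _ => ?_
      obtain ⟨u, hu, huv⟩ := hb.exists_proj (clusterSpace a b n) v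
      have h1 : v - u ∈ W := huv
      rw [hbot, Submodule.mem_bot, sub_eq_zero] at h1
      rwa [h1]
    rw [htop] at this
    exact Module.Finite.equiv (Submodule.topEquiv (R := ℝ) (M := H))
  obtain ⟨μ, hμ, hmin, x, hxW, hbx, hax⟩ := h.exists_rayleigh_min W hWc hWne
  have hx0 : x ≠ 0 := by
    rintro rfl
    simp at hbx
  -- First-order optimality on `W`; on `clusterSpace` both sides vanish.
  have hxe : x ∈ eigenspace a b μ := by
    intro v
    obtain ⟨u, hu, huv⟩ := hb.exists_proj (clusterSpace a b n) v
    have hw : v - u ∈ W := huv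
    have h1 : a x u = 0 := h.left_orthogonal_clusterSpace hxW u hu
    have h2 : b x u = 0 := hxW u hu
    have h3 : a x (v - u) = μ * b x (v - u) := by
      have h4 : ∀ w ∈ W, 0 ≤ (a - μ • b) w w := by
        intro w hw
        have := hmin w hw
        simp only [LinearMap.sub_apply, LinearMap.smul_apply, smul_eq_mul]
        linarith
      have h5 := form_sq_le (c := (a - μ • b).restrict W)
        (fun v w => by
          simp only [LinearMap.BilinForm.restrict_apply, LinearMap.domRestrict_apply,
            LinearMap.sub_apply, LinearMap.smul_apply, ha.symm (v : H) w, hb.symm (v : H) w])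
        (fun v => h4 v v.2) ⟨x, hxW⟩ ⟨v - u, hw⟩
      simp only [LinearMap.BilinForm.restrict_apply, LinearMap.domRestrict_apply,
            LinearMap.sub_apply, LinearMap.smul_apply, smul_eq_mul, hax, hbx, mul_one, sub_self,
            zero_mul] at h5
      nlinarith [pow_eq_zero_iff (two_ne_zero) |>.1 (le_antisymm h5 (sq_nonneg _))]
    rw [map_sub, map_sub, h1, h2, sub_zero, sub_zero] at h3
    exact h3
  have hlt : eigval a b n < μ := by
    cases n with
    | zero => exact hμ
    | succ k =>
      have h1 := (ih k k.lt_succ_self).2.2 x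
        (fun w hw => hxW w (clusterSpace_mono k.le_succ hw))
      rw [hbx, hax, mul_one] at h1
      refine lt_of_le_of_ne h1 fun heq => ?_
      have h2 : x ∈ M a b (k + 1) := by
        rw [M, heq]
        exact hxe
      have h3 := hxW x (M_le_clusterSpace (by simp) h2)
      rw [hbx] at h3
      exact one_ne_zero h3
  have hmono : ∀ k ≤ n, eigval a b k ≤ eigval a b n := by
    have : MonotoneOn (eigval a b) (Set.Iic n) := by
      refine monotoneOn_of_le_add_one Set.ordConnected_Iic fun k _ _ hk => ?_
      exact (ih k hk).2.1.le
    exact fun k hk => this hk (Set.mem_Iic.2 le_rfl) hk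
  have hval : eigval a b (n + 1) = μ := by
    refine IsLeast.csInf_eq ⟨⟨⟨x, hx0, hxe⟩, hlt⟩, ?_⟩
    rintro ν ⟨⟨y, hy0, hye⟩, hν⟩
    have hyW : y ∈ W := fun w hw => (h.orthogonal_clusterSpace (fun k hk z hz =>
      h.orthogonal_of_eigen ((hmono k (Finset.mem_Icc.1 hk).2).trans_lt hν).ne' hye hz) w hw).2
    have h1 := hmin y hyW
    rw [hye y] at h1
    exact le_of_mul_le_mul_right h1 (hb.pos y hy0)
  rw [hval]
  exact ⟨⟨x, hx0, hxe⟩, hlt, hmin⟩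

theorem IsFormPair.mult_zero (h : IsFormPair a b) : mult a b 0 = 0 := by
  have hbot : M a b 0 = ⊥ := by
    refine (Submodule.eq_bot_iff _).2 fun u hu => h.inner_left.eq_zero ?_
    have : a u u = 0 * b u u := hu u
    rw [this, zero_mul]
  rw [mult, hbot, finrank_bot]

theorem IsFormPair.clusterDim_eq (h : IsFormPair a b) (q : ℕ) :
    clusterDim a b q = ∑ k ∈ Finset.range (q + 1), mult a b k := by
  rw [clusterDim]
  induction q with
  | zero => simp [h.mult_zero]
  | succ n ih => rw [Finset.sum_Icc_succ_top (by omega), ih, Finset.sum_range_succ _ (n + 1)]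

variable [CompleteSpace H]

theorem IsFormPair.eigval_strictMono (h : IsFormPair a b) (hH : ¬ FiniteDimensional ℝ H) :
    StrictMono (eigval a b) :=
  strictMono_nat_of_lt_succ fun n => (h.eigval_succ_spec hH n).2.1

theorem IsFormPair.eigval_pos (h : IsFormPair a b) (hH : ¬ FiniteDimensional ℝ H) {i : ℕ}
    (hi : 1 ≤ i) : 0 < eigval a b i :=
  h.eigval_strictMono hH (Nat.pos_of_ne_zero (Nat.one_le_iff_ne_zero.1 hi))

theorem IsFormPair.eigval_one_mul_le (h : IsFormPair a b) (hH : ¬ FiniteDimensional ℝ H)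
    (v : H) : eigval a b 1 * b v v ≤ a v v :=
  (h.eigval_succ_spec hH 0).2.2 v fun w hw => by
    rw [clusterSpace_zero, Submodule.mem_bot] at hw
    rw [hw, map_zero]

theorem IsFormPair.orthogonal_M_clusterSpace (h : IsFormPair a b)
    (hH : ¬ FiniteDimensional ℝ H) {n i : ℕ} (hi : n < i) {u : H} (hu : u ∈ M a b i) :
    ∀ w ∈ clusterSpace a b n, a u w = 0 ∧ b u w = 0 :=
  h.orthogonal_clusterSpace fun _ hk _ hw => h.orthogonal_of_eigen
    (h.eigval_strictMono hH ((Finset.mem_Icc.1 hk).2.trans_lt hi)).ne' hu hw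

/-- The Rayleigh quotient is at most `λ_n` on `M(λ₁) ⊕ ⋯ ⊕ M(λ_n)`. -/
theorem IsFormPair.left_le_on_clusterSpace (h : IsFormPair a b) (hH : ¬ FiniteDimensional ℝ H)
    (n : ℕ) : ∀ u ∈ clusterSpace a b n, a u u ≤ eigval a b n * b u u := by
  induction n with
  | zero =>
    intro u hu
    rw [clusterSpace_zero, Submodule.mem_bot] at hu
    simp [hu]
  | succ n ih =>
    intro u hu
    rw [clusterSpace_succ] at hu
    obtain ⟨w, hw, m, hm, rfl⟩ := Submodule.mem_sup.1 hu
    obtain ⟨h1, h2⟩ := h.orthogonal_M_clusterSpace hH n.lt_succ_self hm w hw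
    have h3 : a m m = _ * b m m := hm m
    have h4 := ih w hw
    have h5 := mul_le_mul_of_nonneg_right (h.eigval_succ_spec hH n).2.1.le
      (h.inner_right.nonneg w)
    rw [add_comm w m, form_add_self h.inner_left.symm, form_add_self h.inner_right.symm, h1, h2,
      h3]
    linarith

theorem IsFormPair.finrank_clusterSpace (h : IsFormPair a b) (hH : ¬ FiniteDimensional ℝ H)
    (n : ℕ) : Module.finrank ℝ (clusterSpace a b n) = ∑ k ∈ Finset.range (n + 1), mult a b k := by
  induction n with
  | zero => rw [clusterSpace_zero, finrank_bot, Finset.sum_range_one, h.mult_zero]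
  | succ n ih =>
    have := h.finiteDimensional_clusterSpace n
    have : FiniteDimensional ℝ (M a b (n + 1)) := h.finiteDimensional_eigenspace _
    have hinf : clusterSpace a b n ⊓ M a b (n + 1) = ⊥ := by
      refine (Submodule.eq_bot_iff _).2 fun u hu => h.inner_right.eq_zero ?_
      exact (h.orthogonal_M_clusterSpace hH n.lt_succ_self hu.2 u hu.1).2
    have h1 := Submodule.finrank_sup_add_finrank_inf_eq (clusterSpace a b n) (M a b (n + 1))
    rw [hinf, finrank_bot, add_zero, ih] at h1
    rw [clusterSpace_succ, h1, Finset.sum_range_succ _ (n + 1)]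
    rfl

end Spectral

/-! ### Distances between subspaces -/

section Dist

variable {H : Type*} [NormedAddCommGroup H] [InnerProductSpace ℝ H]
  {a b : LinearMap.BilinForm ℝ H}

theorem formNorm_smul (t : ℝ) (v : H) : formNorm a (t • v) = |t| * formNorm a v := by
  rw [formNorm, form_smul_self, Real.sqrt_mul (sq_nonneg t), Real.sqrt_sq_eq_abs]
  rfl

theorem formNorm_add_le (ha : IsInnerForm a) (v w : H) :
    formNorm a (v + w) ≤ formNorm a v + formNorm a w := by
  have hv := formNorm_nonneg a v
  have hw := formNorm_nonneg a w
  refine le_of_sq_le_sq ?_ (add_nonneg hv hw)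
  have h1 : a v w ≤ formNorm a v * formNorm a w := by
    refine (le_abs_self _).trans (abs_le_of_sq_le_sq ?_ (mul_nonneg hv hw))
    rw [mul_pow, formNorm_sq ha, formNorm_sq ha]
    exact form_sq_le ha.symm ha.nonneg v w
  rw [formNorm_sq ha, form_add_self ha.symm]
  nlinarith [formNorm_sq ha v, formNorm_sq ha w]

theorem subspaceDist_nonneg (a : LinearMap.BilinForm ℝ H) (U V : Submodule ℝ H) :
    0 ≤ subspaceDist a U V :=
  Real.iSup_nonneg fun _ => Real.iInf_nonneg fun _ => formNorm_nonneg _ _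

theorem bddBelow_range_formNorm (V : Submodule ℝ H) (u : H) :
    BddBelow (Set.range fun v : V => formNorm a (u - v)) :=
  ⟨0, by rintro _ ⟨v, rfl⟩; exact formNorm_nonneg _ _⟩

/-- The error of the `a`-orthogonal projection onto `V` on a vector of `U` is at most
`dist(U, V)` times its norm. -/
theorem IsInnerForm.exists_proj_error_le (ha : IsInnerForm a) (U V : Submodule ℝ H)
    [FiniteDimensional ℝ V] {u : H} (hu : u ∈ U) :
    ∃ p ∈ V, (∀ w ∈ V, a (u - p) w = 0) ∧
      a (u - p) (u - p) ≤ subspaceDist a U V ^ 2 * a u u := by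
  obtain ⟨p, hp, hort⟩ := ha.exists_proj V u
  refine ⟨p, hp, hort, ?_⟩
  by_cases hu0 : u = 0
  · rw [map_sub (a (u - p)), hort p hp, hu0]
    simp
  have hs : 0 < formNorm a u := Real.sqrt_pos.2 (ha.pos u hu0)
  set s := formNorm a u with hsd
  have hunit : formNorm a (s⁻¹ • u) = 1 := by
    rw [formNorm_smul, abs_of_pos (inv_pos.2 hs), ← hsd, inv_mul_cancel₀ hs.ne']
  have h1 : s⁻¹ * formNorm a (u - p) ≤ ⨅ v : V, formNorm a (s⁻¹ • u - (v : H)) := by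
    refine le_ciInf fun v => ?_
    have h2 : s⁻¹ • u - (v : H) = s⁻¹ • (u - s • (v : H)) := by
      rw [smul_sub, smul_smul, inv_mul_cancel₀ hs.ne', one_smul]
    rw [h2, formNorm_smul, abs_of_pos (inv_pos.2 hs)]
    refine mul_le_mul_of_nonneg_left (Real.sqrt_le_sqrt ?_) (inv_pos.2 hs).le
    have h3 : u - s • (v : H) = (u - p) + (p - s • (v : H)) := by abel
    rw [h3, form_add_self ha.symm, hort _ (V.sub_mem hp (V.smul_mem s v.2))]
    linarith [ha.nonneg (p - s • (v : H))]
  have hbdd : BddAbove (Set.range fun u : {u : H // u ∈ U ∧ formNorm a u = 1} =>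
      ⨅ v : V, formNorm a ((u : H) - (v : H))) := by
    refine ⟨1, ?_⟩
    rintro _ ⟨w, rfl⟩
    refine (ciInf_le (bddBelow_range_formNorm V (w : H)) 0).trans ?_
    rw [Submodule.coe_zero, sub_zero, w.2.2]
  have h4 : s⁻¹ * formNorm a (u - p) ≤ subspaceDist a U V :=
    h1.trans (le_ciSup hbdd ⟨s⁻¹ • u, U.smul_mem _ hu, hunit⟩)
  rw [inv_mul_le_iff₀ hs] at h4
  have h5 := pow_le_pow_left₀ (formNorm_nonneg _ _) h4 2
  rw [formNorm_sq ha, mul_pow, formNorm_sq ha] at h5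
  linarith

theorem vecDist_le {u v : H} (hu : 0 < formNorm a u) :
    vecDist a u v ≤ formNorm a (u - v) / formNorm a u := by
  refine Real.iSup_le ?_ (div_nonneg (formNorm_nonneg _ _) hu.le)
  rintro ⟨w, hw, hw1⟩
  obtain ⟨t, rfl⟩ := Submodule.mem_span_singleton.1 hw
  refine (ciInf_le (bddBelow_range_formNorm _ _)
    ⟨t • v, Submodule.smul_mem _ t (Submodule.mem_span_singleton_self v)⟩).trans ?_
  rw [formNorm_smul] at hw1
  rw [← smul_sub, formNorm_smul, eq_div_of_mul_eq hu.ne' hw1, div_mul_eq_mul_div, one_mul]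

end Dist

/-! ### Discrete eigensystems -/

section Discrete

variable {H : Type*} [NormedAddCommGroup H] [InnerProductSpace ℝ H]
  {a b : LinearMap.BilinForm ℝ H} {V : Submodule ℝ H} {lamh : ℕ → ℝ} {uh : ℕ → H}

namespace IsDiscreteEigensystem

theorem linearIndependent (hD : IsDiscreteEigensystem a b V lamh uh) {m : ℕ}
    (hm : m ≤ Module.finrank ℝ V) : LinearIndependent ℝ fun k : Fin m => uh k := by
  refine LinearMap.BilinForm.linearIndependent_of_iIsOrtho (B := b) ?_ ?_
  · intro k l hkl
    change b (uh k) (uh l) = 0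
    rw [hD.orthonormal k l (k.2.trans_le hm) (l.2.trans_le hm),
      if_neg fun h => hkl (Fin.ext h)]
  · intro k h
    have h1 : b (uh k) (uh k) = 0 := h
    rw [hD.orthonormal k k (k.2.trans_le hm) (k.2.trans_le hm), if_pos rfl] at h1
    exact one_ne_zero h1

theorem span_eq (hD : IsDiscreteEigensystem a b V lamh uh) [FiniteDimensional ℝ V] :
    Submodule.span ℝ (Set.range fun k : Fin (Module.finrank ℝ V) => uh k) = V := by
  refine Submodule.eq_of_le_of_finrank_eq ?_ ?_
  · rw [Submodule.span_le]
    rintro _ ⟨k, rfl⟩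
    exact hD.mem k k.2
  · rw [finrank_span_eq_card (hD.linearIndependent le_rfl), Fintype.card_fin]

theorem expansion (hD : IsDiscreteEigensystem a b V lamh uh) (hb : IsInnerForm b)
    [FiniteDimensional ℝ V] {v : H} (hv : v ∈ V) :
    v = ∑ k ∈ Finset.range (Module.finrank ℝ V), b v (uh k) • uh k := by
  set s := ∑ k ∈ Finset.range (Module.finrank ℝ V), b v (uh k) • uh k with hs
  have hsV : s ∈ V :=
    V.sum_mem fun k hk => V.smul_mem _ (hD.mem k (Finset.mem_range.1 hk))
  refine sub_eq_zero.1 (hb.eq_zero ?_)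
  refine form_eq_zero_of_mem_span (s := Set.range fun k : Fin (Module.finrank ℝ V) => uh k) ?_
    (by rw [hD.span_eq]; exact V.sub_mem hv hsV)
  rintro _ ⟨l, rfl⟩
  rw [map_sub, LinearMap.sub_apply, hs, form_sum_left,
    Finset.sum_eq_single_of_mem (l : ℕ) (Finset.mem_range.2 l.2)]
  · rw [map_smul, LinearMap.smul_apply, hD.orthonormal l l l.2 l.2, if_pos rfl, smul_eq_mul,
      mul_one, sub_self]
  · intro k hk hkl
    rw [map_smul, LinearMap.smul_apply, hD.orthonormal k l (Finset.mem_range.1 hk) l.2,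
      if_neg hkl, smul_zero]

theorem right_self_eq_sum (hD : IsDiscreteEigensystem a b V lamh uh) (hb : IsInnerForm b)
    [FiniteDimensional ℝ V] {v : H} (hv : v ∈ V) :
    b v v = ∑ k ∈ Finset.range (Module.finrank ℝ V), b v (uh k) ^ 2 := by
  conv_lhs => rw [hD.expansion hb hv, form_sum_left]
  refine Finset.sum_congr rfl fun k _ => ?_
  rw [← hD.expansion hb hv, map_smul, LinearMap.smul_apply, smul_eq_mul, hb.symm (uh k), sq]

theorem left_self_eq_sum (hD : IsDiscreteEigensystem a b V lamh uh) (hb : IsInnerForm b)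
    [FiniteDimensional ℝ V] {v : H} (hv : v ∈ V) :
    a v v = ∑ k ∈ Finset.range (Module.finrank ℝ V), lamh k * b v (uh k) ^ 2 := by
  conv_lhs => rw [hD.expansion hb hv, form_sum_left]
  refine Finset.sum_congr rfl fun k hk => ?_
  rw [← hD.expansion hb hv, map_smul, LinearMap.smul_apply, smul_eq_mul,
    hD.eigen k (Finset.mem_range.1 hk) v hv, hb.symm (uh k)]
  ring

theorem value_mul_le (hD : IsDiscreteEigensystem a b V lamh uh) (hb : IsInnerForm b)
    [FiniteDimensional ℝ V] {m : ℕ} {v : H} (hv : v ∈ V) (h0 : ∀ k < m, b v (uh k) = 0) :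
    lamh m * b v v ≤ a v v := by
  rw [hD.left_self_eq_sum hb hv, hD.right_self_eq_sum hb hv, Finset.mul_sum]
  refine Finset.sum_le_sum fun k hk => ?_
  rcases lt_or_ge k m with h | h
  · simp [h0 k h]
  · exact mul_le_mul_of_nonneg_right (hD.sorted m k h (Finset.mem_range.1 hk)) (sq_nonneg _)

theorem le_value_mul (hD : IsDiscreteEigensystem a b V lamh uh) (hb : IsInnerForm b)
    [FiniteDimensional ℝ V] {m : ℕ} (hm : m < Module.finrank ℝ V) {v : H} (hv : v ∈ V)
    (h0 : ∀ k, m < k → k < Module.finrank ℝ V → b v (uh k) = 0) :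
    a v v ≤ lamh m * b v v := by
  rw [hD.left_self_eq_sum hb hv, hD.right_self_eq_sum hb hv, Finset.mul_sum]
  refine Finset.sum_le_sum fun k hk => ?_
  rcases lt_or_ge m k with h | h
  · simp [h0 k h (Finset.mem_range.1 hk)]
  · exact mul_le_mul_of_nonneg_right (hD.sorted k m h hm) (sq_nonneg _)

theorem left_self (hD : IsDiscreteEigensystem a b V lamh uh) {m : ℕ}
    (hm : m < Module.finrank ℝ V) : a (uh m) (uh m) = lamh m := by
  rw [hD.eigen m hm _ (hD.mem m hm), hD.orthonormal m m hm hm, if_pos rfl, mul_one]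

theorem value_pos (hD : IsDiscreteEigensystem a b V lamh uh) (h : IsFormPair a b) {m : ℕ}
    (hm : m < Module.finrank ℝ V) : 0 < lamh m := by
  rw [← hD.left_self hm]
  refine h.inner_left.pos _ fun h0 => ?_
  have h1 := hD.orthonormal m m hm hm
  rw [h0, if_pos rfl] at h1
  simp at h1

/-- Lower min-max bound: the discrete eigenvalues past position `dim E_n` are at least
`λ_{n+1}`. -/
theorem eigval_le_value [CompleteSpace H] (hD : IsDiscreteEigensystem a b V lamh uh)
    (h : IsFormPair a b) (hH : ¬ FiniteDimensional ℝ H) [FiniteDimensional ℝ V] {n m : ℕ}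
    (hnm : Module.finrank ℝ (clusterSpace a b n) ≤ m) (hm : m < Module.finrank ℝ V) :
    eigval a b (n + 1) ≤ lamh m := by
  have hb := h.inner_right
  have := h.finiteDimensional_clusterSpace n
  let U := Submodule.span ℝ (Set.range fun k : Fin (m + 1) => uh k)
  have : FiniteDimensional ℝ U := FiniteDimensional.span_of_finite ℝ (Set.finite_range _)
  have hU : Module.finrank ℝ U = m + 1 := by
    rw [finrank_span_eq_card (hD.linearIndependent (Nat.succ_le_of_lt hm)), Fintype.card_fin]
  obtain ⟨v, hvU, hv0, hv⟩ := exists_ne_zero_orthogonal b U (clusterSpace a b n) (by omega)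
  have hvV : v ∈ V := by
    refine Submodule.span_le.2 ?_ hvU
    rintro _ ⟨k, rfl⟩
    exact hD.mem k (by omega)
  have h1 := hD.le_value_mul hb hm hvV fun k hmk hk => by
    rw [hb.symm]
    refine form_eq_zero_of_mem_span ?_ hvU
    rintro _ ⟨l, rfl⟩
    rw [hD.orthonormal k l hk (by omega), if_neg (by omega)]
  exact le_of_mul_le_mul_right (((h.eigval_succ_spec hH n).2.2 v hv).trans h1) (hb.pos v hv0)

/-- Upper min-max bound `λ^h (1 - δ²) ≤ λ_i` for the discrete eigenvalues before position
`dim E_i`, with `δ = dist(E_q, V)` and `i ≤ q`. The trial space is the projection of `E_i` to `V`;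
there the Rayleigh quotient is bounded by projecting back to `E_i`. -/
theorem value_mul_le_eigval [CompleteSpace H] (hD : IsDiscreteEigensystem a b V lamh uh)
    (h : IsFormPair a b) (hH : ¬ FiniteDimensional ℝ H) [FiniteDimensional ℝ V] {q i m : ℕ}
    (hiq : i ≤ q) (hδ : subspaceDist a (clusterSpace a b q) V < 1)
    (hmi : m < Module.finrank ℝ (clusterSpace a b i)) (hm : m < Module.finrank ℝ V) :
    lamh m * (1 - subspaceDist a (clusterSpace a b q) V ^ 2) ≤ eigval a b i := by
  have ha := h.inner_left
  have hb := h.inner_right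
  have := h.finiteDimensional_clusterSpace i
  set δ := subspaceDist a (clusterSpace a b q) V with hδd
  have hδ0 : 0 ≤ δ := subspaceDist_nonneg _ _ _
  let X := Submodule.span ℝ (Set.range fun k : Fin m => uh k)
  have : FiniteDimensional ℝ X := FiniteDimensional.span_of_finite ℝ (Set.finite_range _)
  have hX : Module.finrank ℝ X ≤ m := (finrank_range_le_card _).trans (by simp)
  obtain ⟨u, huE, hu0, hu⟩ := exists_ne_zero_orthogonal a (clusterSpace a b i) X (by omega)
  obtain ⟨p, hpV, hort, herr⟩ :=
    ha.exists_proj_error_le (clusterSpace a b q) V (clusterSpace_mono hiq huE)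
  have hau := ha.pos u hu0
  have hup : a u p = a p p := by
    have := hort p hpV
    rwa [map_sub, LinearMap.sub_apply, sub_eq_zero] at this
  have hpp : (1 - δ ^ 2) * a u u ≤ a p p := by
    rw [form_sub_self ha.symm, hup] at herr
    linarith
  have hδ1 : 0 < 1 - δ ^ 2 := by nlinarith
  have hp0 : 0 < a p p := (mul_pos hδ1 hau).trans_le hpp
  have hL := hD.value_pos h hm
  have h1 : lamh m * b p p ≤ a p p := by
    refine hD.value_mul_le hb hpV fun k hk => ?_
    have hkV := hk.trans hm
    have h2 : a u (uh k) = 0 := hu _ (Submodule.subset_span ⟨⟨k, hk⟩, rfl⟩)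
    have h3 := hort (uh k) (hD.mem k hkV)
    rw [map_sub, LinearMap.sub_apply, h2, zero_sub, neg_eq_zero, ha.symm,
      hD.eigen k hkV p hpV, hb.symm] at h3
    exact (mul_eq_zero.1 h3).resolve_left (hD.value_pos h hkV).ne'
  obtain ⟨z, hz, hzo⟩ := hb.exists_proj (clusterSpace a b i) p
  have hzo' := h.left_orthogonal_clusterSpace hzo
  have hzu : a z u = a p p := by
    have := hzo' u huE
    rw [map_sub, LinearMap.sub_apply] at this
    rw [← hup, ha.symm u p]
    linarith
  have hbz : b z z ≤ b p p := by
    have h2 : p = z + (p - z) := by abel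
    have h3 := form_add_self hb.symm z (p - z)
    rw [← h2, hb.symm z (p - z), hzo z hz] at h3
    linarith [hb.nonneg (p - z)]
  have h4 := h.left_le_on_clusterSpace hH i z hz
  have h5 : a p p * a p p ≤ a z z * a u u := by
    have := form_sq_le ha.symm ha.nonneg z u
    rwa [hzu, sq] at this
  have hli : 0 ≤ eigval a b i := (h.eigval_strictMono hH).monotone (Nat.zero_le i)
  have h6 : lamh m * a z z ≤ eigval a b i * a p p := by
    calc lamh m * a z z ≤ lamh m * (eigval a b i * b p p) :=
          mul_le_mul_of_nonneg_left (h4.trans (mul_le_mul_of_nonneg_left hbz hli)) hL.le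
      _ = eigval a b i * (lamh m * b p p) := by ring
      _ ≤ eigval a b i * a p p := mul_le_mul_of_nonneg_left h1 hli
  have h7 : lamh m * a p p ≤ eigval a b i * a u u := by
    refine le_of_mul_le_mul_right ?_ hp0
    calc lamh m * a p p * a p p = lamh m * (a p p * a p p) := by ring
      _ ≤ lamh m * (a z z * a u u) := mul_le_mul_of_nonneg_left h5 hL.le
      _ = lamh m * a z z * a u u := by ring
      _ ≤ eigval a b i * a p p * a u u := mul_le_mul_of_nonneg_right h6 hau.le
      _ = eigval a b i * a u u * a p p := by ring
  refine le_of_mul_le_mul_right ?_ hau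
  calc lamh m * (1 - δ ^ 2) * a u u = lamh m * ((1 - δ ^ 2) * a u u) := by ring
    _ ≤ lamh m * a p p := mul_le_mul_of_nonneg_left hpp hL.le
    _ ≤ eigval a b i * a u u := h7

end IsDiscreteEigensystem

end Discrete

/-! ### Error of a discrete eigenfunction -/

section Error

variable {H : Type*} [NormedAddCommGroup H] [InnerProductSpace ℝ H] [CompleteSpace H]
  {a b : LinearMap.BilinForm ℝ H}

/-- Uniform bound for the distance of a discrete eigenfunction `u` to `M(λ_{n+1})`, in terms of
the gap `κ` between its discrete eigenvalue `L` and `λ_{n+2}`. The components of `u` below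
`λ_{n+1}` are estimated by testing both eigenvalue problems with that component and its
projection to `V`; those above follow from the energy identity `a(u,u) = L b(u,u)`. -/
theorem IsFormPair.exists_near_eigenvector (h : IsFormPair a b) (hH : ¬ FiniteDimensional ℝ H)
    {q n : ℕ} (hn : n ≤ q) {κ : ℝ} (hκ : 0 < κ) :
    ∃ K : ℝ, 0 ≤ K ∧ ∀ V : Submodule ℝ H, FiniteDimensional ℝ V → ∀ (L : ℝ) (u : H), u ∈ V →
      (∀ v ∈ V, a u v = L * b u v) → b u u = 1 → eigval a b (n + 1) ≤ L →
      L * (1 - subspaceDist a (clusterSpace a b q) V ^ 2) ≤ eigval a b (n + 1) →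
      L ≤ eigval a b (n + 2) - κ →
      ∃ w ∈ M a b (n + 1),
        a (u - w) (u - w) ≤ K * subspaceDist a (clusterSpace a b q) V ^ 2 := by
  have ha := h.inner_left
  have hb := h.inner_right
  have := h.finiteDimensional_clusterSpace n
  have : FiniteDimensional ℝ (M a b (n + 1)) := h.finiteDimensional_eigenspace _
  set l₀ := eigval a b n with hl₀d
  set l₁ := eigval a b (n + 1) with hl₁d
  set l₂ := eigval a b (n + 2) with hl₂d
  set μ := eigval a b 1 with hμd
  have hμ : 0 < μ := h.eigval_pos hH le_rfl
  have h0 : 0 ≤ l₀ := (h.eigval_strictMono hH).monotone (Nat.zero_le n)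
  have h01 : l₀ < l₁ := (h.eigval_succ_spec hH n).2.1
  have h12 : l₁ < l₂ := (h.eigval_succ_spec hH (n + 1)).2.1
  have h2 : 0 < l₂ := by linarith
  set K₁ := l₂ ^ 2 * l₀ / (μ * (l₁ - l₀) ^ 2) with hK₁d
  have hK₁ : 0 ≤ K₁ := by positivity
  refine ⟨l₀ * K₁ + l₂ ^ 2 * (K₁ + 1) / κ, by positivity, ?_⟩
  intro V _ L u huV hueig hu1 hL1 hLδ hLκ
  set δ := subspaceDist a (clusterSpace a b q) V with hδd
  obtain ⟨e, he, heo⟩ := hb.exists_proj (clusterSpace a b n) u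
  have heo' := h.left_orthogonal_clusterSpace heo
  obtain ⟨f, hf, hfo⟩ := hb.exists_proj (M a b (n + 1)) (u - e)
  have hfe := h.orthogonal_M_clusterSpace hH n.lt_succ_self hf
  set r := u - e - f with hrd
  have hro : ∀ w ∈ clusterSpace a b (n + 1), a r w = 0 ∧ b r w = 0 := by
    refine h.orthogonal_clusterSpace fun k hk w hw => ?_
    rcases (Finset.mem_Icc.1 hk).2.eq_or_lt with rfl | hlt
    · exact hfo w hw
    · have hwE : w ∈ clusterSpace a b n :=
        M_le_clusterSpace (Finset.mem_Icc.2 ⟨(Finset.mem_Icc.1 hk).1, by omega⟩) hw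
      rw [hrd, map_sub, LinearMap.sub_apply, heo w hwE, (hfe w hwE).2, sub_zero]
  have hre := hro e (clusterSpace_mono n.le_succ he)
  have hrf := hro f (M_le_clusterSpace (by simp) hf)
  have hfeq : a f f = l₁ * b f f := hf f
  have hsplit : ∀ {c : LinearMap.BilinForm ℝ H}, IsInnerForm c → c f e = 0 → c r e = 0 →
      c r f = 0 → c u u = c e e + c f f + c r r := by
    intro c hc h1 h2 h3
    have hu : u = r + (f + e) := by rw [hrd]; abel
    rw [hu, form_add_self hc.symm, form_add_self hc.symm, map_add, h1, h2, h3]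
    ring
  have hau := hsplit ha (hfe e he).1 hre.1 hrf.1
  have hbu := hsplit hb (hfe e he).2 hre.2 hrf.2
  have haL : a u u = L * b u u := hueig u huV
  have hee := h.left_le_on_clusterSpace hH n e he
  have hbe := hb.nonneg e
  -- The component in `E_n`.
  have hlow : b e e ≤ K₁ * δ ^ 2 := by
    obtain ⟨p, hpV, hort, herr⟩ :=
      ha.exists_proj_error_le (clusterSpace a b q) V (clusterSpace_mono hn he)
    have h1 : a u e = L * b u p := by
      have := hort u huV
      rw [ha.symm, map_sub] at this
      rw [← hueig p hpV]
      linarith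
    have h3 : a u e = a e e := by
      have := heo' e he
      rw [map_sub, LinearMap.sub_apply] at this
      linarith
    have h4 : b u e = b e e := by
      have := heo e he
      rw [map_sub, LinearMap.sub_apply] at this
      linarith
    have h5 : L * b e e - a e e = L * b u (e - p) := by
      rw [map_sub, h4, ← h3, h1]
      ring
    have h6 : (l₁ - l₀) * b e e ≤ L * b u (e - p) := by nlinarith
    have h7 : b u (e - p) ^ 2 ≤ b (e - p) (e - p) := by
      have := form_sq_le hb.symm hb.nonneg u (e - p)
      rwa [hu1, one_mul] at this
    have h8 : μ * b (e - p) (e - p) ≤ δ ^ 2 * (l₀ * b e e) :=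
      (h.eigval_one_mul_le hH _).trans
        (herr.trans (mul_le_mul_of_nonneg_left hee (sq_nonneg δ)))
    have hgap : 0 < l₁ - l₀ := sub_pos.2 h01
    have h9 : ((l₁ - l₀) * b e e) ^ 2 ≤ l₂ ^ 2 * b (e - p) (e - p) := by
      calc ((l₁ - l₀) * b e e) ^ 2 ≤ (L * b u (e - p)) ^ 2 :=
            pow_le_pow_left₀ (mul_nonneg hgap.le hbe) h6 2
        _ = L ^ 2 * b u (e - p) ^ 2 := by ring
        _ ≤ l₂ ^ 2 * b (e - p) (e - p) :=
            mul_le_mul (pow_le_pow_left₀ (by linarith) (by linarith) 2) h7 (sq_nonneg _)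
              (sq_nonneg _)
    have h10 : μ * ((l₁ - l₀) * b e e) ^ 2 ≤ l₂ ^ 2 * (δ ^ 2 * (l₀ * b e e)) := by
      calc μ * ((l₁ - l₀) * b e e) ^ 2 ≤ μ * (l₂ ^ 2 * b (e - p) (e - p)) :=
            mul_le_mul_of_nonneg_left h9 hμ.le
        _ = l₂ ^ 2 * (μ * b (e - p) (e - p)) := by ring
        _ ≤ _ := mul_le_mul_of_nonneg_left h8 (sq_nonneg _)
    rcases hbe.eq_or_lt with hz | hpos
    · rw [← hz]
      positivity
    · rw [hK₁d, div_mul_eq_mul_div, le_div_iff₀ (by positivity)]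
      refine le_of_mul_le_mul_right ?_ hpos
      linarith
  -- The components above `λ_{n+1}`.
  have hrr := (h.eigval_succ_spec hH (n + 1)).2.2 r fun w hw => (hro w hw).2
  have hbf : b f f ≤ 1 := by linarith [hb.nonneg r]
  have hbf0 := hb.nonneg f
  have hbr := hb.nonneg r
  have hae := ha.nonneg e
  have hδ2 := sq_nonneg δ
  have henergy : a r r - L * b r r ≤ l₂ * (K₁ + 1) * δ ^ 2 := by
    have h1 : a r r - L * b r r = L * b e e - a e e + (L - l₁) * b f f := by
      rw [haL, hbu] at hau
      linarith
    have h3 : (L - l₁) * b f f ≤ l₂ * δ ^ 2 := by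
      calc (L - l₁) * b f f ≤ (L - l₁) * 1 :=
            mul_le_mul_of_nonneg_left hbf (by linarith)
        _ ≤ L * δ ^ 2 := by linarith
        _ ≤ l₂ * δ ^ 2 := mul_le_mul_of_nonneg_right (by linarith) hδ2
    have h4 : L * b e e ≤ l₂ * (K₁ * δ ^ 2) :=
      mul_le_mul (by linarith) hlow hbe h2.le
    linarith
  have hhigh : a r r ≤ l₂ ^ 2 * (K₁ + 1) / κ * δ ^ 2 := by
    rw [div_mul_eq_mul_div, le_div_iff₀ hκ]
    have h1 : κ * a r r ≤ l₂ * (a r r - L * b r r) := by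
      have h3 : κ * a r r ≤ (l₂ - L) * a r r :=
        mul_le_mul_of_nonneg_right (by linarith) (ha.nonneg r)
      have h4 : L * (l₂ * b r r) ≤ L * a r r :=
        mul_le_mul_of_nonneg_left hrr (by linarith)
      linarith
    have h5 := mul_le_mul_of_nonneg_left henergy h2.le
    linarith
  refine ⟨f, hf, ?_⟩
  have huf : u - f = r + e := by rw [hrd]; abel
  rw [huf, form_add_self ha.symm, hre.1]
  have h11 : a e e ≤ l₀ * (K₁ * δ ^ 2) := hee.trans (mul_le_mul_of_nonneg_left hlow h0)
  linarith

theorem IsFormPair.idx_bounds (h : IsFormPair a b) (hH : ¬ FiniteDimensional ℝ H) {q n : ℕ}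
    (hn : n + 1 ≤ q) (j : Fin (mult a b (n + 1))) :
    Module.finrank ℝ (clusterSpace a b n) ≤ idx a b (n + 1) j ∧
      idx a b (n + 1) j < Module.finrank ℝ (clusterSpace a b (n + 1)) ∧
      idx a b (n + 1) j < clusterDim a b q := by
  have h1 : idx a b (n + 1) j < ∑ k ∈ Finset.range (n + 2), mult a b k := by
    rw [Finset.sum_range_succ, idx]
    exact Nat.add_lt_add_left j.2 _
  refine ⟨?_, ?_, ?_⟩
  · rw [h.finrank_clusterSpace hH]
    exact Nat.le_add_right _ _
  · rwa [h.finrank_clusterSpace hH]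
  · rw [h.clusterDim_eq]
    exact h1.trans_le (Finset.sum_le_sum_of_subset (Finset.range_mono (by omega)))

/-- The threshold keeps each discrete eigenvalue belonging to `λ_i` below `λ_{i+1}` by
`(1 - α²) (λ_{i+1} - λ_i)`, uniformly in `V`, so that `exists_near_eigenvector` applies with this
gap. -/
theorem IsFormPair.exists_isApproxConst (h : IsFormPair a b) (hH : ¬ FiniteDimensional ℝ H)
    (q : ℕ) {α : ℝ} (hα0 : 0 < α) (hα1 : α < 1) :
    ∃ C : ℝ, IsApproxConst a b q (gapThreshold a b q α) C := by
  set ε := gapThreshold a b q α with hεd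
  have hgap : ∀ n, 0 < eigval a b (n + 1) - eigval a b n := fun n =>
    sub_pos.2 (h.eigval_succ_spec hH n).2.1
  have hpos : ∀ n, 0 < eigval a b (n + 1) := fun n => h.eigval_pos hH (by omega)
  have hε0 : 0 < ε := by
    refine mul_pos hα0 ((Finset.lt_inf'_iff _).2 fun i hi => ?_)
    obtain ⟨n, rfl⟩ := Nat.exists_eq_add_of_le' (Finset.mem_Icc.1 hi).1
    exact Real.sqrt_pos.2 (div_pos (hgap n) (hpos n))
  have hεle : ∀ n ≤ q, ε ≤
      α * Real.sqrt ((eigval a b (n + 1) - eigval a b n) / eigval a b (n + 1)) := by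
    intro n hn
    exact mul_le_mul_of_nonneg_left
      (Finset.inf'_le _ (Finset.mem_Icc.2 (⟨by omega, by omega⟩ : 1 ≤ n + 1 ∧ n + 1 ≤ q + 1)))
      hα0.le
  have hε1 : ε < 1 := by
    refine (hεle 0 (Nat.zero_le q)).trans_lt ?_
    have h0 : eigval a b 0 = 0 := rfl
    rw [zero_add, h0, sub_zero, div_self (hpos 0).ne', Real.sqrt_one, mul_one]
    exact hα1
  have hα2 : 0 < 1 - α ^ 2 := by nlinarith
  have hκ : ∀ n, 0 < (1 - α ^ 2) * (eigval a b (n + 2) - eigval a b (n + 1)) :=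
    fun n => mul_pos hα2 (hgap (n + 1))
  have hK : ∀ n : ℕ, ∃ K : ℝ, 0 ≤ K ∧ (n ≤ q → ∀ V : Submodule ℝ H, FiniteDimensional ℝ V →
      ∀ (L : ℝ) (u : H), u ∈ V →
      (∀ v ∈ V, a u v = L * b u v) → b u u = 1 → eigval a b (n + 1) ≤ L →
      L * (1 - subspaceDist a (clusterSpace a b q) V ^ 2) ≤ eigval a b (n + 1) →
      L ≤ eigval a b (n + 2) - (1 - α ^ 2) * (eigval a b (n + 2) - eigval a b (n + 1)) →
      ∃ w ∈ M a b (n + 1),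
        a (u - w) (u - w) ≤ K * subspaceDist a (clusterSpace a b q) V ^ 2) := by
    intro n
    by_cases hn : n ≤ q
    · obtain ⟨K, hK0, hK⟩ := h.exists_near_eigenvector hH hn (hκ n)
      exact ⟨K, hK0, fun _ => hK⟩
    · exact ⟨0, le_rfl, fun hn' => absurd hn' hn⟩
  choose K hK0 hK using hK
  have hsum : ∀ s : Finset ℕ, 0 ≤ ∑ n ∈ s, Real.sqrt (K n) :=
    fun s => Finset.sum_nonneg fun n _ => Real.sqrt_nonneg _
  refine ⟨1 + ∑ n ∈ Finset.range q, Real.sqrt (K n), hε0, hε1, by linarith [hsum (Finset.range q)],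
    ?_⟩
  intro V hV hdim lamh uh hD hδ i hi j
  obtain ⟨hi1, hiq⟩ := Finset.mem_Icc.1 hi
  obtain ⟨n, rfl⟩ := Nat.exists_eq_add_of_le' hi1
  set δ := subspaceDist a (clusterSpace a b q) V with hδd
  have hδ0 : 0 ≤ δ := subspaceDist_nonneg _ _ _
  obtain ⟨hm1, hm2, hm3⟩ := h.idx_bounds hH hiq j
  set m := idx a b (n + 1) j with hmd
  have hmV : m < Module.finrank ℝ V := hm3.trans_le hdim
  have hL1 := hD.eigval_le_value h hH hm1 hmV
  have hL2 := hD.value_mul_le_eigval h hH hiq (hδ.trans_lt hε1) hm2 hmV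
  rw [← hδd] at hL2
  have hL := hD.value_pos h hmV
  have hLκ : lamh m ≤
      eigval a b (n + 2) - (1 - α ^ 2) * (eigval a b (n + 2) - eigval a b (n + 1)) := by
    have hl2 : 0 < eigval a b (n + 2) := hpos (n + 1)
    have hg : 0 < eigval a b (n + 2) - eigval a b (n + 1) := hgap (n + 1)
    have h1 : δ ^ 2 * eigval a b (n + 2) ≤
        α ^ 2 * (eigval a b (n + 2) - eigval a b (n + 1)) := by
      have h2 := pow_le_pow_left₀ hδ0 (hδ.trans (hεle (n + 1) hiq)) 2
      rwa [mul_pow, Real.sq_sqrt (div_pos (hgap (n + 1)) (hpos (n + 1))).le, mul_div_assoc',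
        le_div_iff₀ (hpos (n + 1))] at h2
    set l₁ := eigval a b (n + 1)
    set l₂ := eigval a b (n + 2)
    set g := l₂ - l₁ with hgd
    -- With `L (l₂ - α² g) ≤ l₁ l₂`, the bound `L ≤ l₂ - (1 - α²) g` follows from
    -- `l₁ l₂ ≤ (l₂ - (1 - α²) g) (l₂ - α² g)`.
    have h3 : lamh m * (l₂ - α ^ 2 * g) ≤ l₁ * l₂ := by
      have h4 := mul_le_mul_of_nonneg_right hL2 hl2.le
      have h5 := mul_le_mul_of_nonneg_left h1 hL.le
      linarith
    have hl1 : 0 < l₁ := hpos n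
    have hden : 0 < l₂ - α ^ 2 * g := by nlinarith
    refine le_of_mul_le_mul_right (h3.trans ?_) hden
    have h6 : 0 ≤ (1 - α ^ 2) * α ^ 2 * g ^ 2 := by positivity
    have h7 : l₁ = l₂ - g := by rw [hgd]; ring
    rw [h7]
    linarith
  obtain ⟨w, hw, hwK⟩ := hK n (by omega) V hV (lamh m) (uh m) (hD.mem m hmV) (hD.eigen m hmV)
    (by rw [hD.orthonormal m m hmV hmV, if_pos rfl]) hL1 hL2 hLκ
  refine ⟨w, hw, ?_⟩
  calc formNorm a (uh m - w) ≤ Real.sqrt (K n * δ ^ 2) := Real.sqrt_le_sqrt hwK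
    _ = Real.sqrt (K n) * δ := by rw [Real.sqrt_mul (hK0 n), Real.sqrt_sq hδ0]
    _ ≤ (1 + ∑ n ∈ Finset.range q, Real.sqrt (K n)) * δ := by
      refine mul_le_mul_of_nonneg_right ?_ hδ0
      have := Finset.single_le_sum (f := fun n => Real.sqrt (K n))
        (fun n _ => Real.sqrt_nonneg _) (Finset.mem_range.2 (by omega : n < q))
      linarith

end Error

/-! ### Orthonormal eigenbases near the discrete eigenfunctions -/

section Bases

variable {H : Type*} [NormedAddCommGroup H] [InnerProductSpace ℝ H] [CompleteSpace H]
  {a b : LinearMap.BilinForm ℝ H}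

/-- If `d_i` many `b`-orthonormal vectors lie within `η` of `M(λ_i)`, then some `b`-orthonormal
basis of `M(λ_i)` matches them with error `2 η / √λ₁`, in the sense of `vecDist`. The basis is the
symmetric orthogonalization of their projections to `M(λ_i)`. -/
theorem IsFormPair.exists_basis_near (h : IsFormPair a b) (hH : ¬ FiniteDimensional ℝ H)
    {i : ℕ} (hi : 1 ≤ i) {x : Fin (mult a b i) → H}
    (hx : ∀ j l, b (x j) (x l) = if j = l then 1 else 0) {η : ℝ}
    (hη : ∀ j, ∃ w ∈ M a b i, formNorm a (x j - w) ≤ η) :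
    ∃ g : Fin (mult a b i) → H, Submodule.span ℝ (Set.range g) = M a b i ∧
      (∀ j l, b (g j) (g l) = if j = l then 1 else 0) ∧
      ∀ j, vecDist a (g j) (x j) ≤ 2 * η / Real.sqrt (eigval a b 1) := by
  have ha := h.inner_left
  have hb := h.inner_right
  have : FiniteDimensional ℝ (M a b i) := h.finiteDimensional_eigenspace _
  have hMa : ∀ v ∈ M a b i, ∀ z, a v z = eigval a b i * b v z := fun v hv => hv
  choose f hf hfo using fun j => hb.exists_proj (M a b i) (x j)
  have hfo' : ∀ j, ∀ w ∈ M a b i, a (x j - f j) w = 0 := by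
    intro j w hw
    rw [ha.symm, hMa w hw, hb.symm, hfo j w hw, mul_zero]
  -- The projection is at least as close as any other element of `M(λ_i)`.
  have hnear : ∀ j, formNorm a (x j - f j) ≤ η := by
    intro j
    obtain ⟨w, hw, hwη⟩ := hη j
    refine le_trans (Real.sqrt_le_sqrt ?_) hwη
    have h1 : x j - w = (x j - f j) + (f j - w) := by abel
    rw [h1, form_add_self ha.symm, hfo' j _ ((M a b i).sub_mem (hf j) hw)]
    linarith [ha.nonneg (f j - w)]
  have hgram : ∀ y : Fin (mult a b i) → ℝ,
      b (∑ j, y j • f j) (∑ j, y j • f j) ≤ ∑ j, y j ^ 2 := by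
    intro y
    have h1 : b (∑ j, y j • x j) (∑ j, y j • x j) = ∑ j, y j ^ 2 := by
      rw [form_sum_left]
      refine Finset.sum_congr rfl fun j _ => ?_
      rw [map_sum, Finset.sum_eq_single_of_mem j (Finset.mem_univ j)]
      · simp [hx, sq]
      · intro l _ hl
        simp [hx, hl.symm]
    have hF : ∑ j, y j • f j ∈ M a b i :=
      (M a b i).sum_mem fun j _ => (M a b i).smul_mem _ (hf j)
    have h2 : b (∑ j, y j • (x j - f j)) (∑ j, y j • f j) = 0 := by
      rw [form_sum_left]
      refine Finset.sum_eq_zero fun j _ => ?_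
      rw [map_smul, LinearMap.smul_apply, hfo j _ hF, smul_zero]
    have h3 : ∑ j, y j • x j = ∑ j, y j • (x j - f j) + ∑ j, y j • f j := by
      rw [← Finset.sum_add_distrib]
      refine Finset.sum_congr rfl fun j _ => ?_
      rw [← smul_add, sub_add_cancel]
    rw [← h1, h3, form_add_self hb.symm, h2]
    linarith [hb.nonneg (∑ j, y j • (x j - f j))]
  have hbM : IsInnerForm (b.restrict (M a b i)) :=
    ⟨fun v w => hb.symm v w, fun v hv => hb.pos v fun h0 => hv (Subtype.ext h0)⟩
  obtain ⟨g, hspan, hort, hdef⟩ := hbM.exists_orthonormal_near (d := mult a b i) rfl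
    (fun j => ⟨f j, hf j⟩) (fun y => by
      have hs : ((∑ j, y j • (⟨f j, hf j⟩ : M a b i) : M a b i) : H) = ∑ j, y j • f j := by simp
      rw [LinearMap.BilinForm.restrict_apply, LinearMap.domRestrict_apply, hs]
      exact hgram y)
  have hμ : 0 < eigval a b 1 := h.eigval_pos hH le_rfl
  have hlam : 0 < eigval a b i := h.eigval_pos hH hi
  have hμlam : eigval a b 1 ≤ eigval a b i := (h.eigval_strictMono hH).monotone hi
  refine ⟨fun j => g j, ?_, hort, fun j => ?_⟩
  · have h1 : Set.range (fun j => (g j : H)) = (M a b i).subtype '' Set.range g := by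
      rw [← Set.range_comp]
      rfl
    rw [h1, Submodule.span_image, hspan, Submodule.map_top, Submodule.range_subtype]
  · have hη0 : 0 ≤ η := (formNorm_nonneg _ _).trans (hnear j)
    have hgg : b (g j : H) (g j : H) = 1 := by
      have := hort j j
      rwa [if_pos rfl] at this
    have hgn : formNorm a (g j : H) = Real.sqrt (eigval a b i) := by
      rw [formNorm, hMa _ (g j).2, hgg, mul_one]
    have hdef' : b (g j - f j : H) (g j - f j : H) ≤ b (x j - f j) (x j - f j) := by
      have h1 : b (g j - f j : H) (g j - f j : H) ≤ 1 - b (f j) (f j) := hdef j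
      have h2 := hfo j (f j) (hf j)
      have h3 := form_sub_self hb.symm (x j) (f j)
      have h4 := hx j j
      rw [if_pos rfl] at h4
      rw [map_sub, LinearMap.sub_apply] at h2
      linarith
    have h5 : formNorm a (g j - f j : H) ≤
        Real.sqrt (eigval a b i) * (η / Real.sqrt (eigval a b 1)) := by
      rw [formNorm, hMa _ ((M a b i).sub_mem (g j).2 (hf j)), Real.sqrt_mul hlam.le]
      refine mul_le_mul_of_nonneg_left ?_ (Real.sqrt_nonneg _)
      rw [le_div_iff₀ (Real.sqrt_pos.2 hμ), ← Real.sqrt_mul (hb.nonneg _)]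
      refine le_trans (Real.sqrt_le_sqrt ?_) (hnear j)
      calc b (g j - f j : H) (g j - f j : H) * eigval a b 1
          ≤ b (x j - f j) (x j - f j) * eigval a b 1 := mul_le_mul_of_nonneg_right hdef' hμ.le
        _ = eigval a b 1 * b (x j - f j) (x j - f j) := mul_comm _ _
        _ ≤ a (x j - f j) (x j - f j) := h.eigval_one_mul_le hH _
    have hslam : 0 < Real.sqrt (eigval a b i) := Real.sqrt_pos.2 hlam
    have h6 : η ≤ Real.sqrt (eigval a b i) * (η / Real.sqrt (eigval a b 1)) := by
      rw [mul_div_assoc', le_div_iff₀ (Real.sqrt_pos.2 hμ), mul_comm]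
      exact mul_le_mul_of_nonneg_right (Real.sqrt_le_sqrt hμlam) hη0
    have h7 : formNorm a (g j - x j : H) ≤
        formNorm a (g j - f j : H) + formNorm a (x j - f j) := by
      have h8 : (g j - x j : H) = (g j - f j) + (-1 : ℝ) • (x j - f j) := by
        rw [neg_one_smul]; abel
      have h9 := formNorm_add_le ha (g j - f j : H) ((-1 : ℝ) • (x j - f j))
      rwa [← h8, formNorm_smul, abs_neg, abs_one, one_mul] at h9
    refine (vecDist_le (by rwa [hgn])).trans ?_
    rw [hgn, div_le_iff₀ hslam]
    have h10 := hnear j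
    calc formNorm a (g j - x j : H)
        ≤ 2 * (Real.sqrt (eigval a b i) * (η / Real.sqrt (eigval a b 1))) := by linarith
      _ = 2 * η / Real.sqrt (eigval a b 1) * Real.sqrt (eigval a b i) := by ring

theorem IsFormPair.two_div_le_basisConst (h : IsFormPair a b) (hH : ¬ FiniteDimensional ℝ H)
    {q : ℕ} (hq : 1 ≤ q) {C : ℝ} (hC : 0 < C) :
    2 * C / Real.sqrt (eigval a b 1) ≤ basisConst a b q hq C := by
  have hμ : 0 < Real.sqrt (eigval a b 1) := Real.sqrt_pos.2 (h.eigval_pos hH le_rfl)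
  refine le_trans ?_ (Finset.le_sup' (fun i =>
    2 * (Real.sqrt (mult a b i : ℝ) + 1) / Real.sqrt (eigval a b i) * C)
    (Finset.mem_Icc.2 ⟨le_rfl, hq⟩))
  rw [div_mul_eq_mul_div]
  refine div_le_div_of_nonneg_right ?_ hμ.le
  nlinarith [Real.sqrt_nonneg (mult a b 1 : ℝ)]

end Bases

end ClusterEig

theorem mainTheorem4 {H : Type*} [NormedAddCommGroup H] [InnerProductSpace ℝ H]
    [CompleteSpace H] [TopologicalSpace.SeparableSpace H]
    (hH : ¬ FiniteDimensional ℝ H)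
    (a b : LinearMap.BilinForm ℝ H)
    (ha_symm : ∀ v w : H, a v w = a w v)
    (ha_bdd : ∃ Ca : ℝ, 0 < Ca ∧ ∀ v w : H, a v w ≤ Ca * ‖v‖ * ‖w‖)
    (ha_coer : ∃ ca : ℝ, 0 < ca ∧ ∀ v : H, ca * ‖v‖ ^ 2 ≤ a v v)
    (hb_symm : ∀ v w : H, b v w = b w v)
    (hb_pos : ∀ v : H, v ≠ 0 → 0 < b v v)
    (hb_cpt : ClusterEig.FormNormCompact b)
    (q : ℕ) (hq : 1 ≤ q) :
    -- Admissible constants exist, and the threshold can be taken explicit.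
    (∀ α : ℝ, 0 < α → α < 1 →
      ∃ C : ℝ, ClusterEig.IsApproxConst a b q (ClusterEig.gapThreshold a b q α) C) ∧
    -- For any admissible constants, the estimate holds with `b`-orthonormal exact bases.
    (∀ ε C : ℝ, ClusterEig.IsApproxConst a b q ε C →
      ∀ V : Submodule ℝ H, FiniteDimensional ℝ V →
        ClusterEig.clusterDim a b q ≤ Module.finrank ℝ V →
        ∀ (lamh : ℕ → ℝ) (uh : ℕ → H), ClusterEig.IsDiscreteEigensystem a b V lamh uh →
          ClusterEig.subspaceDist a (ClusterEig.clusterSpace a b q) V ≤ ε →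
          ∃ uo : (i : ℕ) → Fin (ClusterEig.mult a b i) → H,
            (∀ i ∈ Finset.Icc 1 q,
              Submodule.span ℝ (Set.range (uo i)) = ClusterEig.M a b i) ∧
            (∀ i ∈ Finset.Icc 1 q, ∀ k ∈ Finset.Icc 1 q,
              ∀ (j : Fin (ClusterEig.mult a b i)) (l : Fin (ClusterEig.mult a b k)),
                b (uo i j) (uo k l) = if i = k ∧ (j : ℕ) = (l : ℕ) then 1 else 0) ∧
            (∀ i ∈ Finset.Icc 1 q, ∀ j : Fin (ClusterEig.mult a b i),
              ClusterEig.vecDist a (uo i j) (uh (ClusterEig.idx a b i j)) ≤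
                ClusterEig.basisConst a b q hq C *
                  ClusterEig.subspaceDist a (ClusterEig.clusterSpace a b q) V)) := by
  obtain ⟨Ca, hCa, hbdd⟩ := ha_bdd
  obtain ⟨ca, hca, hcoer⟩ := ha_coer
  have h : ClusterEig.IsFormPair a b :=
    { inner_left := ⟨ha_symm, fun v hv => lt_of_lt_of_le
        (mul_pos hca (pow_pos (norm_pos_iff.2 hv) 2)) (hcoer v)⟩
      inner_right := ⟨hb_symm, hb_pos⟩
      bdd := ⟨Ca, hCa, fun v => (hbdd v v).trans_eq (by ring)⟩
      coer := ⟨ca, hca, hcoer⟩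
      cpt := hb_cpt }
  refine ⟨fun α hα0 hα1 => h.exists_isApproxConst hH q hα0 hα1, ?_⟩
  rintro ε C ⟨-, -, hC, happ⟩ V hV hdim lamh uh hD hδ
  set δ := ClusterEig.subspaceDist a (ClusterEig.clusterSpace a b q) V
  have hδ0 : 0 ≤ δ := ClusterEig.subspaceDist_nonneg _ _ _
  have hbasis : ∀ i : ℕ, ∃ g : Fin (ClusterEig.mult a b i) → H, i ∈ Finset.Icc 1 q →
      Submodule.span ℝ (Set.range g) = ClusterEig.M a b i ∧
      (∀ j l, b (g j) (g l) = if j = l then 1 else 0) ∧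
      ∀ j : Fin (ClusterEig.mult a b i),
        ClusterEig.vecDist a (g j) (uh (ClusterEig.idx a b i j)) ≤
          2 * (C * δ) / Real.sqrt (ClusterEig.eigval a b 1) := by
    intro i
    by_cases hi : i ∈ Finset.Icc 1 q
    · obtain ⟨hi1, hiq⟩ := Finset.mem_Icc.1 hi
      obtain ⟨n, rfl⟩ := Nat.exists_eq_add_of_le' hi1
      obtain ⟨g, hg⟩ := h.exists_basis_near hH hi1
        (x := fun j => uh (ClusterEig.idx a b (n + 1) j)) (η := C * δ)
        (fun j l => by
          rw [hD.orthonormal _ _ ((h.idx_bounds hH hiq j).2.2.trans_le hdim)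
            ((h.idx_bounds hH hiq l).2.2.trans_le hdim)]
          simp only [ClusterEig.idx, Nat.add_left_cancel_iff, Fin.val_inj])
        (happ V hV hdim lamh uh hD hδ (n + 1) hi)
      exact ⟨g, fun _ => hg⟩
    · exact ⟨fun _ => 0, fun hi' => absurd hi' hi⟩
  choose g hg using hbasis
  refine ⟨g, fun i hi => (hg i hi).1, fun i hi k hk j l => ?_, fun i hi j => ?_⟩
  · by_cases hik : i = k
    · subst hik
      rw [(hg i hi).2.1 j l]
      simp only [true_and, Fin.val_inj]
    · rw [if_neg fun h' => hik h'.1]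
      have hmem : ∀ {i : ℕ}, i ∈ Finset.Icc 1 q → ∀ j, g i j ∈ ClusterEig.M a b i := by
        intro i hi j
        rw [← (hg i hi).1]
        exact Submodule.subset_span ⟨j, rfl⟩
      exact h.orthogonal_of_eigen ((h.eigval_strictMono hH).injective.ne hik) (hmem hi j)
        (hmem hk l)
  · refine ((hg i hi).2.2 j).trans ?_
    calc 2 * (C * δ) / Real.sqrt (ClusterEig.eigval a b 1)
        = 2 * C / Real.sqrt (ClusterEig.eigval a b 1) * δ := by ring
      _ ≤ ClusterEig.basisConst a b q hq C * δ :=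
        mul_le_mul_of_nonneg_right (h.two_div_le_basisConst hH hq hC) hδ0
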